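/- Let $g\ge 2$, let $\Gamma_g=\pi_1(\Sigma_g)$ be the fundamental group of the closed orientable surface $\Sigma_g$ of genus $g$, and let $\mathrm{Homeo}^+(S^1)$ be the group of orientation-preserving homeomorphisms of the circle with the compact-open topology. Give $\mathrm{Hom}(\Gamma_g,\mathrm{Homeo}^+(S^1))$ the topology of pointwise convergence on $\Gamma_g$. Two representations are called $\chi$-equivalent if they define the same point of the largest Hausdorff quotient of $\mathrm{Hom}(\Gamma_g,\mathrm{Homeo}^+(S^1))/\mathrm{Homeo}^+(S^1)$ (quotient by conjugation), and a representation is called path-rigid if its path component in $\mathrm{Hom}(\Gamma_g,\mathrm{Homeo}^+(S^1))$ is contained in a single $\chi$-equivalence class. Let $\rho\colon\Gamma_g\to\mathrm{Homeo}^+(S^1)$ be path-rigid, let $1\le h\le g-1$, and let $\Sigma'\subset\Sigma_g$ be a one-holed subsurface of genus $h$ (for instance $h=g-1$). Suppose that every one-holed torus $T\subset\Sigma'$ is very good, that is, $\rho(\pi_1 T)$ has a finite orbit in $S^1$. Then $\rho(\pi_1\Sigma')$ has a finite orbit in $S^1$. Here the one-holed subsurfaces of genus $h$ are taken at the level of fundamental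 groups: for the presentation $\Gamma_g=\langle a_1,b_1,\dots,a_g,b_g\mid [a_g,b_g]\cdots[a_1,b_1]=1\rangle$ with $[a,b]=b^{-1}a^{-1}ba$, the subgroups $\pi_1\Sigma'\le\Gamma_g$ are the images of $\langle a_1,b_1,\dots,a_h,b_h\rangle$ under automorphisms of $\Gamma_g$ (equivalently, under self-homeomorphisms of $\Sigma_g$), and $T\subset\Sigma'$ means $\pi_1T\le\pi_1\Sigma'$. -/

import Mathlib

/-! ### The group of orientation-preserving homeomorphisms of the circle -/

/-- `F`, an element of the group of increasing homeomorphisms of the line commuting with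
`x ↦ x + 1` (the units of the monoid `CircleDeg1Lift`), is a lift of the self-homeomorphism `f`
of the circle `ℝ / ℤ`. -/
def IsLiftOf (F : CircleDeg1Liftˣ) (f : UnitAddCircle ≃ₜ UnitAddCircle) : Prop :=
  ∀ x : ℝ, ((F x : ℝ) : UnitAddCircle) = f (x : UnitAddCircle)

/-- The group of orientation-preserving homeomorphisms of the circle `ℝ / ℤ`: those that lift to
an increasing homeomorphism of the line commuting with `x ↦ x + 1`. -/
def HomeoPlus : Subgroup (UnitAddCircle ≃ₜ UnitAddCircle) where
  carrier := {f | ∃ F : CircleDeg1Liftˣ, IsLiftOf F f}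
  mul_mem' := by
    rintro f g ⟨F, hF⟩ ⟨G, hG⟩
    refine ⟨F * G, fun x => ?_⟩
    have h1 := hF ((G : CircleDeg1Lift) x)
    have h2 := hG x
    simp only [Units.val_mul, CircleDeg1Lift.mul_apply, Homeomorph.mul_apply]
    rw [h1, h2]
  one_mem' := ⟨1, fun x => by simp⟩
  inv_mem' := by
    rintro f ⟨F, hF⟩
    refine ⟨F⁻¹, fun x => ?_⟩
    have h1 := hF ((F⁻¹ : CircleDeg1Liftˣ) x)
    rw [CircleDeg1Lift.units_apply_inv_apply] at h1
    rw [h1, Homeomorph.inv_apply, Homeomorph.symm_apply_apply]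

/-- The compact-open topology on the group of orientation-preserving homeomorphisms. -/
instance HomeoPlus.instTopologicalSpace : TopologicalSpace HomeoPlus :=
  TopologicalSpace.induced
    (fun f : HomeoPlus =>
      ((f : UnitAddCircle ≃ₜ UnitAddCircle) : C(UnitAddCircle, UnitAddCircle)))
    inferInstance

/-! ### Surface groups and their one-holed subsurfaces -/

/-- Labels of the standard generators: `(i, false)` stands for `a_(i+1)` and `(i, true)` for
`b_(i+1)`. -/
abbrev SurfaceGen (g : ℕ) : Type := Fin g × Bool

/-- The commutator in the convention `[a, b] = b⁻¹ a⁻¹ b a`. -/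
def surfaceComm {G : Type*} [Group G] (a b : G) : G := b⁻¹ * a⁻¹ * b * a

/-- The word `[a_g, b_g] ⋯ [a_1, b_1]`. -/
def surfaceRelator (g : ℕ) : FreeGroup (SurfaceGen g) :=
  ((List.ofFn fun i : Fin g =>
    surfaceComm (FreeGroup.of (i, false)) (FreeGroup.of (i, true))).reverse).prod

/-- The fundamental group of the closed orientable surface of genus `g`, in its standard
presentation `⟨a_1, b_1, …, a_g, b_g | [a_g, b_g] ⋯ [a_1, b_1] = 1⟩`. -/
abbrev SurfaceGroup (g : ℕ) : Type :=
  PresentedGroup ({surfaceRelator g} : Set (FreeGroup (SurfaceGen g)))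

/-- A standard system of loops of the closed surface of genus `g`, written
`s (i, false) = a_(i+1)`, `s (i, true) = b_(i+1)`: a tuple of elements of the surface group that
is the image of the standard generating tuple under an automorphism. By the theorem of Dehn,
Nielsen and Baer, the automorphisms of the surface group are the maps induced by the
self-homeomorphisms of the surface (together with a choice of a path from the base point to its
image), so these are the homeomorphic images of the picture of standard loops. -/
def IsStandardSystem {g : ℕ} (s : SurfaceGen g → SurfaceGroup g) : Prop :=
  ∃ φ : SurfaceGroup g ≃* SurfaceGroup g, ∀ j, s j = φ (PresentedGroup.of j)

/-- `H` is the fundamental group of a one-holed subsurface of genus `h` of the closed surface of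
genus `g` (where `h < g`), the inclusion of the subsurface being made based by a choice of a path
to it from the base point. Every such subsurface is the image, under a
self-homeomorphism of the surface, of the regular neighbourhood of the loops
`a_1, b_1, …, a_h, b_h` of the standard picture, and its fundamental group is generated by the
first `h` pairs of loops of a standard system. -/
def IsOneHoledSubsurfaceGroup {g : ℕ} (h : ℕ) (H : Subgroup (SurfaceGroup g)) : Prop :=
  ∃ s : SurfaceGen g → SurfaceGroup g, IsStandardSystem s ∧
    H = Subgroup.closure (s '' {j | (j.1 : ℕ) < h})

/-! ### Representation space, character space, path-rigidity -/

section Representations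

/-- The set `Hom(Γ, Homeo⁺(S¹))` of actions of the (discrete) group `Γ` on the circle. -/
abbrev CircleRep (Γ : Type*) [Group Γ] : Type _ := Γ →* HomeoPlus

/-- The compact-open topology on `Hom(Γ, Homeo⁺(S¹))`, `Γ` being discrete: the topology of
pointwise convergence on `Γ`. -/
instance CircleRep.instTopologicalSpace (Γ : Type*) [Group Γ] : TopologicalSpace (CircleRep Γ) :=
  TopologicalSpace.induced (fun (ρ : CircleRep Γ) (γ : Γ) => ρ γ) inferInstance

/-- Conjugacy of representations. -/
def CircleRep.conjSetoid (Γ : Type*) [Group Γ] : Setoid (CircleRep Γ) where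
  r ρ σ := ∃ f : HomeoPlus, ∀ γ, σ γ = f * ρ γ * f⁻¹
  iseqv :=
    { refl := fun ρ => ⟨1, fun γ => by simp⟩
      symm := by
        rintro ρ σ ⟨f, hf⟩
        exact ⟨f⁻¹, fun γ => by rw [hf]; group⟩
      trans := by
        rintro ρ σ τ ⟨f, hf⟩ ⟨k, hk⟩
        exact ⟨k * f, fun γ => by rw [hk, hf]; group⟩ }

/-- The character space: the largest Hausdorff quotient of `Hom(Γ, Homeo⁺(S¹)) / Homeo⁺(S¹)`. -/
abbrev CircleCharacterSpace (Γ : Type*) [Group Γ] : Type _ :=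
  T2Quotient (Quotient (CircleRep.conjSetoid Γ))

/-- The point of the character space given by a representation. -/
def CircleRep.character {Γ : Type*} [Group Γ] (ρ : CircleRep Γ) : CircleCharacterSpace Γ :=
  T2Quotient.mk (Quotient.mk (CircleRep.conjSetoid Γ) ρ)

/-- Two representations are `χ`-equivalent if they give the same point of the character space. -/
def CircleRep.ChiEquiv {Γ : Type*} [Group Γ] (ρ σ : CircleRep Γ) : Prop :=
  ρ.character = σ.character

/-- A representation is path-rigid if its path component in `Hom(Γ, Homeo⁺(S¹))` is contained in a
single `χ`-equivalence class. -/
def CircleRep.PathRigid {Γ : Type*} [Group Γ] (ρ : CircleRep Γ) : Prop :=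
  pathComponent ρ ⊆ {σ | CircleRep.ChiEquiv ρ σ}

/-- The subgroup `H` has a finite orbit on the circle under the action `ρ`. -/
def CircleRep.HasFiniteOrbit {Γ : Type*} [Group Γ] (ρ : CircleRep Γ) (H : Subgroup Γ) : Prop :=
  ∃ x : UnitAddCircle,
    {y : UnitAddCircle | ∃ γ ∈ H, y = (ρ γ : UnitAddCircle ≃ₜ UnitAddCircle) x}.Finite

end Representations

/-!
Bending `ρ` along a curve, that is, multiplying the value of a generator by the elements of a path
in the centralizer of the value of the dual generator, moves `ρ` within its path component. The
rotation number of each element is conjugation invariant and continuous, so path-rigidity makes it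
constant on that component. Translation numbers of lifts vary continuously, hence they are constant
too, and by Ghys' theorem equal translation numbers make every bending of `ρ` semiconjugate to `ρ`.

Suppose that two words preserve a finite set `X` of the circle and are multiplied by the bending
elements `C` and `D` when `ρ` is bent at generators of two different handles whose duals have fixed
points. A small `C` makes the periodic set of the first word nowhere dense. This set contains the
image of `X` under the semiconjugacy `ζ`, and the second bent word preserves that image. But `D` can
be chosen so that this word moves a point of the nowhere dense set off it unless both `D` and the
dual of the second generator almost fix its image under the unbent word. In the limit, `ζ` commutes
with both words on `X`, and the dual of the second generator fixes `ζ(X)`.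

The theorem follows by induction on the number of handles. The induction hypothesis and Dehn twists
(Euclid's algorithm on rotation numbers) make the rotation numbers of `a_i` and `b_{i+1}` zero,
whence both have fixed points. An automorphism mixing the last two handles then provides a finite
set to which the squeezing argument applies twice, and the result is invariant under all generators.
-/

open Filter Topology Set CircleDeg1Lift

/-- The group of increasing homeomorphisms of the line commuting with `x ↦ x + 1`, the universal
cover of the group of orientation-preserving homeomorphisms of the circle. -/
abbrev LineLift : Type := CircleDeg1Liftˣ

/-! ### Pointwise convergence and translation numbers -/

theorem tendsto_apply_of_monotone {α β ι : Type*} [TopologicalSpace α] [LinearOrder α]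
    [OrderTopology α] [DenselyOrdered α] [NoMinOrder α] [NoMaxOrder α] [TopologicalSpace β]
    [LinearOrder β] [OrderTopology β] {l : Filter ι} {G : ι → α → β} {f : α → β} {u : ι → α}
    {x : α} (hG : ∀ i, Monotone (G i)) (hf : ContinuousAt f x)
    (h : ∀ y, Tendsto (G · y) l (𝓝 (f y))) (hu : Tendsto u l (𝓝 x)) :
    Tendsto (fun i => G i (u i)) l (𝓝 (f x)) := by
  refine tendsto_order.2 ⟨fun a ha => ?_, fun a ha => ?_⟩
  · obtain ⟨y, hay, hyx⟩ : ∃ y, a < f y ∧ y < x :=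
      (((hf.eventually (lt_mem_nhds ha)).filter_mono nhdsWithin_le_nhds).and
        (self_mem_nhdsWithin (s := Iio x))).exists
    filter_upwards [(h y).eventually (lt_mem_nhds hay), hu.eventually (lt_mem_nhds hyx)]
      with i hi hui using hi.trans_le (hG i hui.le)
  · obtain ⟨y, hay, hxy⟩ : ∃ y, f y < a ∧ x < y :=
      (((hf.eventually (gt_mem_nhds ha)).filter_mono nhdsWithin_le_nhds).and
        (self_mem_nhdsWithin (s := Ioi x))).exists
    filter_upwards [(h y).eventually (gt_mem_nhds hay), hu.eventually (gt_mem_nhds hxy)]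
      with i hi hui using (hG i hui.le).trans_lt hi

theorem tendsto_pow_apply {ι : Type*} {l : Filter ι} {G : ι → CircleDeg1Lift}
    {F : CircleDeg1Lift} (hF : Continuous F) (h : ∀ x, Tendsto (G · x) l (𝓝 (F x)))
    (n : ℕ) (x : ℝ) : Tendsto (fun i => (G i ^ n) x) l (𝓝 ((F ^ n) x)) := by
  induction n with
  | zero => simpa using tendsto_const_nhds
  | succ n ih =>
    simp only [pow_succ', CircleDeg1Lift.mul_apply]
    exact tendsto_apply_of_monotone (fun i => (G i).monotone) hF.continuousAt h ih

theorem tendsto_translationNumber {ι : Type*} {l : Filter ι} {G : ι → CircleDeg1Lift}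
    {F : CircleDeg1Lift} (hF : Continuous F) (h : ∀ x, Tendsto (G · x) l (𝓝 (F x))) :
    Tendsto (fun i => translationNumber (G i)) l (𝓝 (translationNumber F)) := by
  rw [Metric.tendsto_nhds]
  intro ε hε
  obtain ⟨N, hN⟩ := exists_nat_gt (3 / ε)
  have hN0 : (0 : ℝ) < N := (by positivity : (0 : ℝ) < 3 / ε).trans hN
  have hNε : 3 < N * ε := by rwa [div_lt_iff₀ hε] at hN
  filter_upwards [Metric.tendsto_nhds.1 (tendsto_pow_apply hF h N 0) 1 one_pos] with i hi
  have hG := dist_pow_map_zero_mul_translationNumber_le (G i) N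
  have hF := dist_pow_map_zero_mul_translationNumber_le F N
  rw [Real.dist_eq] at *
  rw [abs_le] at hG hF
  rw [abs_lt] at *
  constructor <;> nlinarith

theorem translationNumber_eq_add_int {F G : CircleDeg1Lift} {n : ℤ}
    (h : ∀ x : ℝ, F x = G x + n) : translationNumber F = translationNumber G + n := by
  have hF : F = translate (Multiplicative.ofAdd (n : ℝ)) * G := by
    ext x; simp [h x, add_comm]
  have hcomm : Commute
      ((translate (Multiplicative.ofAdd (n : ℝ)) : LineLift) : CircleDeg1Lift) G := by
    ext x; simp
  rw [hF, translationNumber_mul_of_commute hcomm, translationNumber_translate, add_comm]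

namespace LineLift

protected theorem continuous (F : LineLift) : Continuous (F : ℝ → ℝ) := by
  rw [← coe_toOrderIso]; exact (toOrderIso F).continuous

protected theorem strictMono (F : LineLift) : StrictMono (F : ℝ → ℝ) := by
  rw [← coe_toOrderIso]; exact (toOrderIso F).strictMono

protected theorem ext {F G : LineLift} (h : ∀ x : ℝ, F x = G x) : F = G :=
  Units.ext (CircleDeg1Lift.ext h)

protected theorem mul_apply (F G : LineLift) (x : ℝ) : (F * G) x = F (G x) := rfl

protected theorem inv_apply_eq_iff (F : LineLift) {x y : ℝ} : F⁻¹ x = y ↔ x = F y := by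
  constructor <;> rintro rfl <;> simp

/-- A family of lifts is pointwise continuous if each point moves continuously with the
parameter. -/
def PointwiseContinuous {Y : Type*} [TopologicalSpace Y] (G : Y → LineLift) : Prop :=
  ∀ x : ℝ, Continuous fun s => G s x

namespace PointwiseContinuous

variable {Y : Type*} [TopologicalSpace Y] {G H : Y → LineLift}

protected theorem const (F : LineLift) : PointwiseContinuous fun _ : Y => F :=
  fun _ => continuous_const

protected theorem apply (hG : PointwiseContinuous G) {u : Y → ℝ} (hu : Continuous u) :
    Continuous fun s => G s (u s) :=
  continuous_iff_continuousAt.2 fun s =>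
    tendsto_apply_of_monotone (fun i => (G i).strictMono.monotone) (G s).continuous.continuousAt
      (fun x => (hG x).tendsto s) (hu.tendsto s)

protected theorem uncurry (hG : PointwiseContinuous G) :
    Continuous fun p : Y × ℝ => G p.1 p.2 :=
  PointwiseContinuous.apply (G := fun p : Y × ℝ => G p.1) (fun x => (hG x).comp continuous_fst)
    continuous_snd

protected theorem mul (hG : PointwiseContinuous G) (hH : PointwiseContinuous H) :
    PointwiseContinuous fun s => G s * H s :=
  fun x => hG.apply (hH x)

protected theorem inv (hG : PointwiseContinuous G) : PointwiseContinuous fun s => (G s)⁻¹ := by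
  refine fun x => continuous_iff_continuousAt.2 fun s =>
    tendsto_order.2 ⟨fun a ha => ?_, fun a ha => ?_⟩
  · have hax : G s a < x := by simpa using (G s).strictMono ha
    filter_upwards [((hG a).tendsto s).eventually (gt_mem_nhds hax)] with i hi
    simpa using (G i)⁻¹.strictMono hi
  · have hxa : x < G s a := by simpa using (G s).strictMono ha
    filter_upwards [((hG a).tendsto s).eventually (lt_mem_nhds hxa)] with i hi
    simpa using (G i)⁻¹.strictMono hi

protected theorem translationNumber (hG : PointwiseContinuous G) :
    Continuous fun s => translationNumber (G s) :=
  continuous_iff_continuousAt.2 fun s =>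
    tendsto_translationNumber (G s).continuous fun x => (hG x).tendsto s

end PointwiseContinuous

/-! ### The projection to the circle -/

theorem coe_eq_coe_iff {x y : ℝ} :
    (x : UnitAddCircle) = (y : UnitAddCircle) ↔ ∃ n : ℤ, x = y + n := by
  rw [← sub_eq_zero, ← AddCircle.coe_sub, AddCircle.coe_eq_zero_iff]
  simp only [zsmul_eq_mul, mul_one, eq_comm (b := x - y), sub_eq_iff_eq_add']

theorem coe_add_int (x : ℝ) (n : ℤ) : ((x + n : ℝ) : UnitAddCircle) = x :=
  coe_eq_coe_iff.2 ⟨n, rfl⟩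

theorem eq_of_continuous_of_coe_eq {Y : Type*} [TopologicalSpace Y] [PreconnectedSpace Y]
    {u : Y → ℝ} (hu : Continuous u)
    (h : ∀ s t, ((u s : ℝ) : UnitAddCircle) = ((u t : ℝ) : UnitAddCircle)) (s t : Y) :
    u s = u t :=
  (AddCircle.isCoveringMap_coe 1).const_of_comp hu h s t

/-- The self-map of the circle induced by a lift. -/
noncomputable def circleMap (F : LineLift) : UnitAddCircle → UnitAddCircle :=
  Function.Periodic.lift (f := fun x : ℝ => ((F x : ℝ) : UnitAddCircle)) (c := 1) fun x => by
    simp only [map_add_one, AddCircle.coe_add, AddCircle.coe_period, add_zero]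

@[simp] theorem circleMap_coe (F : LineLift) (x : ℝ) :
    circleMap F (x : UnitAddCircle) = ((F x : ℝ) : UnitAddCircle) :=
  Function.Periodic.lift_coe _ _

theorem continuous_circleMap (F : LineLift) : Continuous (circleMap F) :=
  Continuous.quotient_lift ((AddCircle.continuous_mk' 1).comp F.continuous) _

theorem circleMap_inv_circleMap (F : LineLift) (z : UnitAddCircle) :
    circleMap F⁻¹ (circleMap F z) = z := by
  induction z using QuotientAddGroup.induction_on with
  | H x => simp only [circleMap_coe, units_inv_apply_apply]

/-- The homeomorphism of the circle induced by a lift. -/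
noncomputable def circleHomeomorph (F : LineLift) : UnitAddCircle ≃ₜ UnitAddCircle where
  toFun := circleMap F
  invFun := circleMap F⁻¹
  left_inv := circleMap_inv_circleMap F
  right_inv z := by simpa only [inv_inv] using circleMap_inv_circleMap F⁻¹ z
  continuous_toFun := continuous_circleMap F
  continuous_invFun := continuous_circleMap F⁻¹

@[simp] theorem circleHomeomorph_coe (F : LineLift) (x : ℝ) :
    circleHomeomorph F (x : UnitAddCircle) = ((F x : ℝ) : UnitAddCircle) :=
  circleMap_coe F x

theorem isLiftOf_iff {F : LineLift} {f : UnitAddCircle ≃ₜ UnitAddCircle} :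
    IsLiftOf F f ↔ circleHomeomorph F = f := by
  refine ⟨fun h => ?_, fun h x => by rw [← h, circleHomeomorph_coe]⟩
  ext z
  induction z using QuotientAddGroup.induction_on with
  | H x => exact (circleHomeomorph_coe F x).trans (h x)

/-- The projection of the universal cover onto the group of orientation-preserving homeomorphisms
of the circle. -/
noncomputable def toHomeoPlus : LineLift →* HomeoPlus where
  toFun F := ⟨circleHomeomorph F, F, isLiftOf_iff.2 rfl⟩
  map_one' := Subtype.ext (isLiftOf_iff.1 fun x => by simp)
  map_mul' F G := Subtype.ext (isLiftOf_iff.1 fun x => by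
    simp only [Units.val_mul, CircleDeg1Lift.mul_apply, Subgroup.coe_mul,
      Homeomorph.mul_apply, circleHomeomorph_coe])

theorem toHomeoPlus_apply (F : LineLift) (x : ℝ) :
    (toHomeoPlus F : UnitAddCircle ≃ₜ UnitAddCircle) (x : UnitAddCircle)
      = ((F x : ℝ) : UnitAddCircle) :=
  circleHomeomorph_coe F x

theorem toHomeoPlus_surjective : Function.Surjective toHomeoPlus := by
  rintro ⟨f, F, hF⟩
  exact ⟨F, Subtype.ext (isLiftOf_iff.1 hF)⟩

theorem toHomeoPlus_eq_iff {F G : LineLift} :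
    toHomeoPlus F = toHomeoPlus G ↔ ∃ n : ℤ, ∀ x : ℝ, F x = G x + n := by
  constructor
  · intro h
    have hcoe (x : ℝ) : ((F x : ℝ) : UnitAddCircle) = ((G x : ℝ) : UnitAddCircle) := by
      rw [← toHomeoPlus_apply, h, toHomeoPlus_apply]
    obtain ⟨n, hn⟩ := coe_eq_coe_iff.1 (hcoe 0)
    have hconst (x : ℝ) : F x - G x = F 0 - G 0 :=
      eq_of_continuous_of_coe_eq (u := fun x => F x - G x) (F.continuous.sub G.continuous)
        (fun s t => by simp only [AddCircle.coe_sub, hcoe, sub_self]) x 0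
    exact ⟨n, fun x => by linarith [hconst x]⟩
  · rintro ⟨n, hn⟩
    refine Subtype.ext (isLiftOf_iff.1 fun x => ?_)
    rw [hn x, coe_add_int]
    exact (toHomeoPlus_apply G x).symm

theorem PointwiseContinuous.toHomeoPlus {Y : Type*} [TopologicalSpace Y] {G : Y → LineLift}
    (hG : PointwiseContinuous G) : Continuous fun s => LineLift.toHomeoPlus (G s) := by
  refine continuous_induced_rng.2 (ContinuousMap.continuous_of_continuous_uncurry _ ?_)
  have hquot : IsOpenQuotientMap (Prod.map (id : Y → Y) (fun x : ℝ => (x : UnitAddCircle))) :=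
    IsOpenQuotientMap.id.prodMap QuotientAddGroup.isOpenQuotientMap_mk
  refine hquot.isQuotientMap.continuous_iff.2 (((AddCircle.continuous_mk' 1).comp hG.uncurry).congr
    fun p => (toHomeoPlus_apply (G p.1) p.2).symm)

end LineLift

/-! ### Rotation numbers -/

namespace HomeoPlus

open LineLift

/-- An arbitrarily chosen lift of an orientation-preserving homeomorphism of the circle. -/
noncomputable def someLift (f : HomeoPlus) : LineLift :=
  (toHomeoPlus_surjective f).choose

@[simp] theorem toHomeoPlus_someLift (f : HomeoPlus) : toHomeoPlus (someLift f) = f :=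
  (toHomeoPlus_surjective f).choose_spec

/-- Poincaré's rotation number: the class modulo `1` of the translation number of any lift. -/
noncomputable def rotationNumber (f : HomeoPlus) : UnitAddCircle :=
  ((translationNumber (someLift f) : ℝ) : UnitAddCircle)

theorem rotationNumber_toHomeoPlus (F : LineLift) :
    rotationNumber (toHomeoPlus F) = ((translationNumber F : ℝ) : UnitAddCircle) := by
  obtain ⟨n, hn⟩ := toHomeoPlus_eq_iff.1 (toHomeoPlus_someLift (toHomeoPlus F))
  exact coe_eq_coe_iff.2 ⟨n, translationNumber_eq_add_int hn⟩

theorem rotationNumber_conj (f k : HomeoPlus) :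
    rotationNumber (k * f * k⁻¹) = rotationNumber f := by
  obtain ⟨F, rfl⟩ := toHomeoPlus_surjective f
  obtain ⟨K, rfl⟩ := toHomeoPlus_surjective k
  rw [← map_inv, ← map_mul, ← map_mul, rotationNumber_toHomeoPlus, rotationNumber_toHomeoPlus]
  exact congrArg _ (translationNumber_conj_eq K F)

theorem exists_lift_abs_sub_le (x y : ℝ) (f : HomeoPlus) :
    ∃ G : LineLift, toHomeoPlus G = f ∧ |G x - y| ≤ 1 / 2 := by
  let n : ℤ := round (someLift f x - y)
  have hG (z : ℝ) : (translate (Multiplicative.ofAdd ((-n : ℤ) : ℝ)) * someLift f) z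
      = someLift f z + (-n : ℤ) := by
    rw [LineLift.mul_apply, translate_apply, add_comm]
  refine ⟨translate (Multiplicative.ofAdd ((-n : ℤ) : ℝ)) * someLift f,
    (toHomeoPlus_eq_iff.2 ⟨-n, hG⟩).trans (toHomeoPlus_someLift f), ?_⟩
  have hround : someLift f x + (-n : ℤ) - y = someLift f x - y - n := by push_cast; ring
  rw [hG, hround]
  exact abs_sub_round _

theorem abs_sub_lt_of_dist_lt {F G : LineLift} {ε x₀ : ℝ} (hε : ε ≤ 1 / 2)
    (h₀ : |G x₀ - F x₀| ≤ 1 / 2)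
    (h : ∀ z : UnitAddCircle, dist ((toHomeoPlus F : UnitAddCircle ≃ₜ UnitAddCircle) z)
      ((toHomeoPlus G : UnitAddCircle ≃ₜ UnitAddCircle) z) < ε) (x : ℝ) :
    |G x - F x| < ε := by
  have hcont : Continuous fun x : ℝ => |G x - F x| := (G.continuous.sub F.continuous).abs
  have hclose (y : ℝ) (hy : |G y - F y| ≤ 1 / 2) : |G y - F y| < ε := by
    have hdist := h y
    rwa [toHomeoPlus_apply, toHomeoPlus_apply, dist_comm, dist_eq_norm, ← AddCircle.coe_sub,
      (AddCircle.norm_coe_eq_abs_iff 1 one_ne_zero).2 (by simpa using hy)] at hdist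
  by_contra! hx
  obtain ⟨y, hy : |G y - F y| = ε⟩ :=
    mem_range_of_exists_le_of_exists_ge hcont ⟨x₀, (hclose x₀ h₀).le⟩ ⟨x, hx⟩
  exact (hclose y (hy.trans_le hε)).ne hy

theorem continuous_rotationNumber : Continuous rotationNumber := by
  refine continuous_iff_continuousAt.2 fun f => ?_
  choose G hGlift hG₀ using exists_lift_abs_sub_le 0 (someLift f 0)
  have hpointwise (x : ℝ) : Tendsto (fun k => G k x) (𝓝 f) (𝓝 (someLift f x)) := by
    refine Metric.tendsto_nhds.2 fun ε hε => ?_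
    have huniform := ContinuousMap.tendsto_iff_tendstoUniformly.1
      ((continuous_induced_dom : Continuous fun k : HomeoPlus =>
        ((k : UnitAddCircle ≃ₜ UnitAddCircle) : C(UnitAddCircle, UnitAddCircle))).tendsto f)
    filter_upwards [Metric.tendstoUniformly_iff.1 huniform (min ε (1 / 2)) (by positivity)]
      with k hk
    refine (abs_sub_lt_of_dist_lt (min_le_right ε _) (hG₀ k) (fun z => ?_) x).trans_le
      (min_le_left ε _)
    rw [toHomeoPlus_someLift, hGlift]
    exact hk z
  have hG : rotationNumber = fun k => ((translationNumber (G k) : ℝ) : UnitAddCircle) :=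
    funext fun k => by rw [← rotationNumber_toHomeoPlus, hGlift]
  rw [ContinuousAt, rotationNumber, hG]
  exact ((AddCircle.continuous_mk' 1).tendsto _).comp
    (tendsto_translationNumber (someLift f).continuous hpointwise)

end HomeoPlus

theorem CircleRep.ChiEquiv.rotationNumber_eq {Γ : Type*} [Group Γ] {ρ σ : CircleRep Γ}
    (h : CircleRep.ChiEquiv ρ σ) (γ : Γ) :
    HomeoPlus.rotationNumber (ρ γ) = HomeoPlus.rotationNumber (σ γ) := by
  have hcont : Continuous fun ρ : CircleRep Γ => HomeoPlus.rotationNumber (ρ γ) :=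
    HomeoPlus.continuous_rotationNumber.comp ((continuous_apply γ).comp continuous_induced_dom)
  let rot : Quotient (CircleRep.conjSetoid Γ) → UnitAddCircle :=
    Quotient.lift (fun ρ : CircleRep Γ => HomeoPlus.rotationNumber (ρ γ)) (by
      rintro ρ σ ⟨f, hf⟩
      simp only [hf γ, HomeoPlus.rotationNumber_conj])
  have hrot : Continuous rot := hcont.quotient_lift _
  simpa [CircleRep.character, T2Quotient.lift_mk, rot] using congrArg (T2Quotient.lift hrot) h

/-! ### Translation charts -/

namespace LineLift

variable {Z : LineLift} {l r m x : ℝ}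

theorem inv_apply_eq_self (h : Z x = x) : Z⁻¹ x = x :=
  Z.inv_apply_eq_iff.2 h.symm

theorem zpow_apply_eq_self (h : Z x = x) (k : ℤ) : (Z ^ k) x = x := by
  induction k with
  | zero => simp
  | succ k ih => rw [zpow_add_one, LineLift.mul_apply, h, ih]
  | pred k ih => rw [zpow_sub_one, LineLift.mul_apply, inv_apply_eq_self h, ih]

theorem zpow_add_one_apply (Z : LineLift) (k : ℤ) (x : ℝ) : (Z ^ (k + 1)) x = Z ((Z ^ k) x) := by
  rw [add_comm, zpow_one_add, LineLift.mul_apply]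

theorem apply_mem_Ioo (hl : Z l = l) (hr : Z r = r) (hx : x ∈ Ioo l r) : Z x ∈ Ioo l r :=
  ⟨hl.symm.trans_lt (Z.strictMono hx.1), (Z.strictMono hx.2).trans_eq hr⟩

theorem zpow_apply_mem_Ioo (hl : Z l = l) (hr : Z r = r) (hx : x ∈ Ioo l r) (k : ℤ) :
    (Z ^ k) x ∈ Ioo l r :=
  apply_mem_Ioo (zpow_apply_eq_self hl k) (zpow_apply_eq_self hr k) hx

theorem strictMono_zpow_apply (hl : Z l = l) (hr : Z r = r) (hlt : ∀ x ∈ Ioo l r, x < Z x)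
    (hm : m ∈ Ioo l r) : StrictMono fun k : ℤ => (Z ^ k) m :=
  strictMono_int_of_lt_succ fun k => by
    rw [zpow_add_one_apply]
    exact hlt _ (zpow_apply_mem_Ioo hl hr hm k)

theorem exists_lt_zpow_apply (hlt : ∀ x ∈ Ioo l r, x < Z x) (hm : m ∈ Ioo l r)
    (hx : x ∈ Ioo l r) : ∃ k : ℤ, x < (Z ^ k) m := by
  by_contra! hle
  have hbdd : BddAbove (range fun k : ℤ => (Z ^ k) m) := ⟨x, forall_mem_range.2 hle⟩
  set c := sSup (range fun k : ℤ => (Z ^ k) m)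
  have hc : c ∈ Ioo l r :=
    ⟨hm.1.trans_le (le_csSup hbdd ⟨0, by simp⟩),
      (csSup_le (range_nonempty _) (forall_mem_range.2 hle)).trans_lt hx.2⟩
  have hZc : Z⁻¹ c < c := by simpa using Z⁻¹.strictMono (hlt c hc)
  obtain ⟨_, ⟨k, rfl⟩, hk⟩ := exists_lt_of_lt_csSup (range_nonempty _) hZc
  have hck : c < (Z ^ (k + 1)) m := by
    simpa only [zpow_add_one_apply, units_apply_inv_apply] using Z.strictMono hk
  exact (le_csSup hbdd ⟨k + 1, rfl⟩).not_gt hck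

theorem exists_zpow_apply_mem_Ico (hl : Z l = l) (hr : Z r = r) (hlt : ∀ x ∈ Ioo l r, x < Z x)
    (hm : m ∈ Ioo l r) (hx : x ∈ Ioo l r) : ∃ k : ℤ, x ∈ Ico ((Z ^ k) m) ((Z ^ (k + 1)) m) := by
  obtain ⟨i, hi⟩ := exists_lt_zpow_apply hlt hm hx
  obtain ⟨j, hj⟩ := exists_lt_zpow_apply hlt hx hm
  have hjx : (Z ^ (-j)) m ≤ x := by
    simpa only [zpow_neg, units_inv_apply_apply] using ((Z ^ (-j)).strictMono hj).le
  obtain ⟨k, hk, hmax⟩ := Int.exists_greatest_of_bdd (P := fun k : ℤ => (Z ^ k) m ≤ x)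
    ⟨i, fun z hz => ((strictMono_zpow_apply hl hr hlt hm).lt_iff_lt.1 (hz.trans_lt hi)).le⟩
    ⟨-j, hjx⟩
  exact ⟨k, hk, not_le.1 fun hle => (hmax _ hle).not_gt (lt_add_one k)⟩

/-- `G` is an increasing parametrization of the interval `(l, r)` by the line in which `Z` is the
translation by the integer `e`, of absolute value at most `1`. -/
structure IsTranslationChart (Z : LineLift) (l r : ℝ) (G : ℝ → ℝ) (e : ℤ) : Prop where
  strictMono : StrictMono G
  range_eq : range G = Ioo l r
  map_apply : ∀ s : ℝ, Z (G s) = G (s + e)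
  abs_shift_le : |e| ≤ 1

/-- The chart of an interval of increase of `Z` that is affine from `[0, 1]` onto the fundamental
domain `[m, Z m]` and carries the translation by `1` to `Z`. -/
noncomputable def orbitChart (Z : LineLift) (m s : ℝ) : ℝ :=
  (Z ^ ⌊s⌋) (AffineMap.lineMap m (Z m) (Int.fract s))

theorem orbitChart_add_one (Z : LineLift) (m s : ℝ) :
    orbitChart Z m (s + 1) = Z (orbitChart Z m s) := by
  rw [orbitChart, orbitChart, Int.floor_add_one, Int.fract_add_one, zpow_add_one_apply]

theorem lineMap_fract_mem_Ico (h : m < x) (s : ℝ) :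
    AffineMap.lineMap m x (Int.fract s) ∈ Ico m x :=
  ⟨(left_le_lineMap_iff_nonneg h).2 (Int.fract_nonneg s),
    (lineMap_lt_right_iff_lt_one h).2 (Int.fract_lt_one s)⟩

theorem orbitChart_mem_Ico (hm : m < Z m) (s : ℝ) :
    orbitChart Z m s ∈ Ico ((Z ^ ⌊s⌋) m) ((Z ^ (⌊s⌋ + 1)) m) := by
  have hmem := lineMap_fract_mem_Ico hm s
  rw [zpow_add_one, LineLift.mul_apply]
  exact ⟨(Z ^ ⌊s⌋).strictMono.monotone hmem.1, (Z ^ ⌊s⌋).strictMono hmem.2⟩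

theorem strictMono_orbitChart (hl : Z l = l) (hr : Z r = r) (hlt : ∀ x ∈ Ioo l r, x < Z x)
    (hm : m ∈ Ioo l r) : StrictMono (orbitChart Z m) := by
  intro s t hst
  rcases (Int.floor_mono hst.le).eq_or_lt with heq | hfloor
  · have hfract : Int.fract s < Int.fract t := by
      rw [Int.fract, Int.fract, heq]
      exact sub_lt_sub_right hst _
    rw [orbitChart, orbitChart, heq]
    exact (Z ^ ⌊t⌋).strictMono ((lineMap_lt_lineMap_iff_of_lt' (hlt m hm)).2 hfract)
  · calc orbitChart Z m s < (Z ^ (⌊s⌋ + 1)) m := (orbitChart_mem_Ico (hlt m hm) s).2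
      _ ≤ (Z ^ ⌊t⌋) m := (strictMono_zpow_apply hl hr hlt hm).monotone hfloor
      _ ≤ orbitChart Z m t := (orbitChart_mem_Ico (hlt m hm) t).1

theorem range_orbitChart (hl : Z l = l) (hr : Z r = r) (hlt : ∀ x ∈ Ioo l r, x < Z x)
    (hm : m ∈ Ioo l r) : range (orbitChart Z m) = Ioo l r := by
  refine Subset.antisymm (range_subset_iff.2 fun s => zpow_apply_mem_Ioo hl hr ?_ _)
    fun x hx => ?_
  · have hmem := lineMap_fract_mem_Ico (hlt m hm) s
    exact ⟨hm.1.trans_le hmem.1, hmem.2.trans (apply_mem_Ioo hl hr hm).2⟩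
  · obtain ⟨k, hkx, hxk⟩ := exists_zpow_apply_mem_Ico hl hr hlt hm hx
    have hmZm : 0 < Z m - m := sub_pos.2 (hlt m hm)
    have hmy : m ≤ (Z ^ k)⁻¹ x := by
      simpa only [units_inv_apply_apply] using (Z ^ k)⁻¹.strictMono.monotone hkx
    have hym : (Z ^ k)⁻¹ x < Z m := by
      rw [zpow_add_one, LineLift.mul_apply] at hxk
      simpa only [units_inv_apply_apply] using (Z ^ k)⁻¹.strictMono hxk
    let u := ((Z ^ k)⁻¹ x - m) / (Z m - m)
    have hu : u ∈ Ico (0 : ℝ) 1 :=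
      ⟨div_nonneg (sub_nonneg.2 hmy) hmZm.le, (div_lt_one hmZm).2 (sub_lt_sub_right hym m)⟩
    have hline : AffineMap.lineMap m (Z m) u = (Z ^ k)⁻¹ x := by
      rw [AffineMap.lineMap_apply_ring', div_mul_cancel₀ _ hmZm.ne', sub_add_cancel]
    refine ⟨k + u, ?_⟩
    rw [orbitChart, Int.floor_intCast_add, Int.fract_intCast_add, Int.floor_eq_zero_iff.2 hu,
      Int.fract_eq_self.2 hu, add_zero, hline, units_apply_inv_apply]

theorem isTranslationChart_orbitChart (hl : Z l = l) (hr : Z r = r)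
    (hlt : ∀ x ∈ Ioo l r, x < Z x) (hm : m ∈ Ioo l r) :
    IsTranslationChart Z l r (orbitChart Z m) 1 where
  strictMono := strictMono_orbitChart hl hr hlt hm
  range_eq := range_orbitChart hl hr hlt hm
  map_apply s := by rw [Int.cast_one, orbitChart_add_one]
  abs_shift_le := abs_one.le

namespace IsTranslationChart

variable {G : ℝ → ℝ} {e : ℤ}

theorem isOpenEmbedding (h : IsTranslationChart Z l r G e) : IsOpenEmbedding G :=
  ⟨h.strictMono.isEmbedding_of_ordConnected (h.range_eq ▸ ordConnected_Ioo),
    h.range_eq ▸ isOpen_Ioo⟩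

theorem of_inv (h : IsTranslationChart Z⁻¹ l r G e) : IsTranslationChart Z l r G (-e) where
  strictMono := h.strictMono
  range_eq := h.range_eq
  map_apply s := by
    rw [Z.inv_apply_eq_iff.1 (h.map_apply (s + (-e : ℤ))), Int.cast_neg, neg_add_cancel_right]
  abs_shift_le := (abs_neg e).trans_le h.abs_shift_le

theorem add_int (h : IsTranslationChart Z l r G e) (n : ℤ) :
    IsTranslationChart Z (l + n) (r + n) (fun s => G s + n) e where
  strictMono := h.strictMono.add_const (n : ℝ)
  range_eq := by
    rw [← image_add_const_Ioo, ← h.range_eq, ← range_comp]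
    rfl
  map_apply s := by rw [map_add_int, h.map_apply]
  abs_shift_le := h.abs_shift_le

end IsTranslationChart

theorem exists_strictMono_range_eq_Ioo (hlr : l < r) :
    ∃ G : ℝ → ℝ, StrictMono G ∧ range G = Ioo l r := by
  obtain ⟨φ, hφ, hrange⟩ : ∃ φ : ℝ → ℝ, StrictMono φ ∧ range φ = Ioo (-1) 1 :=
    ⟨fun s => orderIsoIooNegOneOne ℝ s, (orderIsoIooNegOneOne ℝ).strictMono,
      ((orderIsoIooNegOneOne ℝ).surjective.range_comp _).trans Subtype.range_coe⟩
  have hpos : 0 < (r - l) / 2 := half_pos (sub_pos.2 hlr)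
  refine ⟨fun s => (r - l) / 2 * φ s + (l + r) / 2, (hφ.const_mul hpos).add_const _, ?_⟩
  calc range (fun s => (r - l) / 2 * φ s + (l + r) / 2)
      = (fun x => (r - l) / 2 * x + (l + r) / 2) '' Ioo (-1) 1 := by
        rw [← hrange, ← range_comp]
        rfl
    _ = Ioo l r := by
        rw [image_affine_Ioo hpos]
        congr 1 <;> ring

theorem fixed_or_lt_or_gt (h : Disjoint (Ioo l r) (frontier {x | Z x = x})) :
    (∀ x ∈ Ioo l r, Z x = x) ∨ (∀ x ∈ Ioo l r, x < Z x) ∨ ∀ x ∈ Ioo l r, Z x < x := by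
  have hclosed : IsClosed {x : ℝ | Z x = x} := isClosed_eq Z.continuous continuous_id
  by_cases hfix : ∃ x ∈ Ioo l r, Z x = x
  · have hinterior (x : ℝ) (hx : x ∈ Ioo l r) (hZx : x ∈ {x | Z x = x}) :
        x ∈ interior {x | Z x = x} := by
      by_contra hx'
      exact disjoint_left.1 h hx ((mem_frontier_iff_notMem_interior hZx).2 hx')
    obtain ⟨x, hx, hZx⟩ := hfix
    have hsubset : Ioo l r ⊆ {x | Z x = x} :=
      (isPreconnected_Ioo.subset_of_closure_inter_subset isOpen_interior
        ⟨x, hx, hinterior x hx hZx⟩ fun y hy =>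
          hinterior y hy.2 (closure_minimal interior_subset hclosed hy.1)).trans interior_subset
    exact Or.inl fun y hy => hsubset hy
  · push Not at hfix
    by_contra! hcon
    obtain ⟨-, ⟨x, hx, hZx⟩, y, hy, hZy⟩ := hcon
    obtain ⟨z, hz, hZz⟩ := isPreconnected_Ioo.intermediate_value₂ hx hy Z.continuous.continuousOn
      continuousOn_id hZx hZy
    exact hfix z hz hZz

theorem exists_isTranslationChart (hlr : l < r) (hl : Z l = l) (hr : Z r = r)
    (h : Disjoint (Ioo l r) (frontier {x | Z x = x})) : ∃ G e, IsTranslationChart Z l r G e := by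
  have hmid : (l + r) / 2 ∈ Ioo l r := ⟨left_lt_add_div_two.2 hlr, add_div_two_lt_right.2 hlr⟩
  rcases fixed_or_lt_or_gt h with hfix | hlt | hgt
  · obtain ⟨G, hG, hrange⟩ := exists_strictMono_range_eq_Ioo hlr
    refine ⟨G, 0, hG, hrange, fun s => ?_, by simp⟩
    rw [Int.cast_zero, add_zero, hfix _ (hrange ▸ mem_range_self s)]
  · exact ⟨_, 1, isTranslationChart_orbitChart hl hr hlt hmid⟩
  · have hlt (x : ℝ) (hx : x ∈ Ioo l r) : x < Z⁻¹ x := by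
      simpa only [units_apply_inv_apply] using
        hgt _ (apply_mem_Ioo (inv_apply_eq_self hl) (inv_apply_eq_self hr) hx)
    exact ⟨_, -1, (isTranslationChart_orbitChart (inv_apply_eq_self hl) (inv_apply_eq_self hr) hlt
      hmid).of_inv⟩

end LineLift

/-! ### Periodic closed sets and their gaps -/

/-- The set `X` is invariant under the integer translations. -/
def IsIntPeriodic (X : Set ℝ) : Prop :=
  ∀ (x : ℝ) (n : ℤ), x + n ∈ X ↔ x ∈ X

/-- The set `Q` is the preimage of a nonempty closed subset of the circle. -/
structure IsPeriodicClosed (Q : Set ℝ) : Prop where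
  isClosed : IsClosed Q
  nonempty : Q.Nonempty
  periodic : IsIntPeriodic Q

/-- The left endpoint of the gap of `Q` around `x`. -/
noncomputable def gapLeft (Q : Set ℝ) (x : ℝ) : ℝ := sSup (Q ∩ Iic x)

/-- The right endpoint of the gap of `Q` with left endpoint `l`, with value `l` when there is no
such gap. -/
noncomputable def gapRight (Q : Set ℝ) (l : ℝ) : ℝ := sInf (Q ∩ Ioi l)

section Gaps

variable {Q : Set ℝ} {q l x y : ℝ}

theorem le_gapLeft (hq : q ∈ Q) (hqx : q ≤ x) : q ≤ gapLeft Q x :=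
  le_csSup (bddAbove_Iic.mono inter_subset_right) ⟨hq, hqx⟩

theorem gapRight_le (hq : q ∈ Q) (hlq : l < q) : gapRight Q l ≤ q :=
  csInf_le (bddBelow_Ioi.mono inter_subset_right) ⟨hq, hlq⟩

theorem notMem_of_mem_gap (hx : x ∈ Ioo l (gapRight Q l)) : x ∉ Q :=
  fun hxQ => (gapRight_le hxQ hx.1).not_gt hx.2

namespace IsPeriodicClosed

variable (hQ : IsPeriodicClosed Q)
include hQ

theorem nonempty_inter_Iic (x : ℝ) : (Q ∩ Iic x).Nonempty := by
  obtain ⟨q, hq⟩ := hQ.nonempty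
  refine ⟨q + (-⌈q - x⌉ : ℤ), (hQ.periodic _ _).2 hq, ?_⟩
  rw [mem_Iic, Int.cast_neg]
  linarith [Int.le_ceil (q - x)]

theorem nonempty_inter_Ioi (x : ℝ) : (Q ∩ Ioi x).Nonempty := by
  obtain ⟨q, hq⟩ := hQ.nonempty
  refine ⟨q + (1 - ⌊q - x⌋ : ℤ), (hQ.periodic _ _).2 hq, ?_⟩
  rw [mem_Ioi, Int.cast_sub, Int.cast_one]
  linarith [Int.floor_le (q - x)]

theorem gapLeft_mem_inter_Iic (x : ℝ) : gapLeft Q x ∈ Q ∩ Iic x :=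
  (hQ.isClosed.inter isClosed_Iic).csSup_mem (hQ.nonempty_inter_Iic x)
    (bddAbove_Iic.mono inter_subset_right)

theorem gapLeft_mem (x : ℝ) : gapLeft Q x ∈ Q := (hQ.gapLeft_mem_inter_Iic x).1

theorem gapLeft_le (x : ℝ) : gapLeft Q x ≤ x := (hQ.gapLeft_mem_inter_Iic x).2

theorem gapRight_mem (l : ℝ) : gapRight Q l ∈ Q :=
  hQ.isClosed.closure_subset_iff.2 inter_subset_left
    (csInf_mem_closure (hQ.nonempty_inter_Ioi l) (bddBelow_Ioi.mono inter_subset_right))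

theorem mem_gap (hx : x ∉ Q) : x ∈ Ioo (gapLeft Q x) (gapRight Q (gapLeft Q x)) := by
  have hle : x ≤ gapRight Q (gapLeft Q x) :=
    le_csInf (hQ.nonempty_inter_Ioi _) fun q hq =>
      not_lt.1 fun hqx => (le_gapLeft hq.1 hqx.le).not_gt hq.2
  exact ⟨(hQ.gapLeft_le x).lt_of_ne fun h => hx (h ▸ hQ.gapLeft_mem x),
    hle.lt_of_ne fun h => hx (h ▸ hQ.gapRight_mem _)⟩

theorem gapLeft_eq_of_mem_gap (hl : l ∈ Q) (hx : x ∈ Ioo l (gapRight Q l)) : gapLeft Q x = l :=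
  le_antisymm
    (not_lt.1 fun hlt => ((gapRight_le (hQ.gapLeft_mem x) hlt).trans (hQ.gapLeft_le x)).not_gt hx.2)
    (le_gapLeft hl hx.1.le)

theorem gapLeft_add_int (x : ℝ) (n : ℤ) : gapLeft Q (x + n) = gapLeft Q x + n := by
  have hle (x : ℝ) (n : ℤ) : gapLeft Q x + n ≤ gapLeft Q (x + n) :=
    le_gapLeft ((hQ.periodic _ _).2 (hQ.gapLeft_mem x)) (by gcongr; exact hQ.gapLeft_le x)
  refine le_antisymm ?_ (hle x n)
  have hback := hle (x + n) (-n)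
  rwa [Int.cast_neg, add_neg_cancel_right, ← sub_eq_add_neg, sub_le_iff_le_add] at hback

theorem gapRight_add_int (l : ℝ) (n : ℤ) : gapRight Q (l + n) = gapRight Q l + n := by
  have hle (l : ℝ) (n : ℤ) : gapRight Q l + n ≤ gapRight Q (l + n) := by
    refine le_csInf (hQ.nonempty_inter_Ioi _) fun q hq => ?_
    have hq' : q + (-n : ℤ) ∈ Q := (hQ.periodic _ _).2 hq.1
    have hlq : l < q + (-n : ℤ) := by
      rw [Int.cast_neg, ← sub_eq_add_neg]
      exact lt_sub_iff_add_lt.2 hq.2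
    have := gapRight_le hq' hlq
    rwa [Int.cast_neg, ← sub_eq_add_neg, le_sub_iff_add_le] at this
  refine le_antisymm ?_ (hle l n)
  have hback := hle (l + n) (-n)
  rwa [Int.cast_neg, add_neg_cancel_right, ← sub_eq_add_neg, sub_le_iff_le_add] at hback

end IsPeriodicClosed

end Gaps

/-! ### Systems of translation charts -/

/-- Translation charts of all the gaps of a periodic closed set of fixed points of `Z` with empty
interior, compatible with the integer translations. Charts are indexed by the left endpoints of
the gaps; their values at other indices are irrelevant. -/
structure ChartSystem (Z : LineLift) where
  /-- The complement of the gaps. -/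
  base : Set ℝ
  isPeriodicClosed : IsPeriodicClosed base
  interior_base : interior base = ∅
  map_eq : ∀ x ∈ base, Z x = x
  /-- The chart of the gap with left endpoint `l`. -/
  chart : ℝ → ℝ → ℝ
  /-- The translation by which `Z` acts in the chart with left endpoint `l`. -/
  shift : ℝ → ℤ
  isTranslationChart : ∀ l ∈ base, l < gapRight base l →
    LineLift.IsTranslationChart Z l (gapRight base l) (chart l) (shift l)
  chart_add_int : ∀ (l s : ℝ) (n : ℤ), chart (l + n) s = chart l s + n

namespace LineLift

theorem isIntPeriodic_frontier_fixed (Z : LineLift) : IsIntPeriodic (frontier {x | Z x = x}) := by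
  intro x n
  have hinvariant : (Homeomorph.addRight (n : ℝ)) ⁻¹' {x : ℝ | Z x = x} = {x | Z x = x} := by
    ext y
    simp
  have hpreimage := (Homeomorph.addRight (n : ℝ)).preimage_frontier {x : ℝ | Z x = x}
  rw [hinvariant] at hpreimage
  exact Set.ext_iff.1 hpreimage x

theorem exists_base {Z : LineLift} {q : ℝ} (hq : Z q = q) :
    ∃ Q : Set ℝ, IsPeriodicClosed Q ∧ interior Q = ∅ ∧ (∀ x ∈ Q, Z x = x) ∧
      frontier {x | Z x = x} ⊆ Q := by
  have hclosed : IsClosed {x : ℝ | Z x = x} := isClosed_eq Z.continuous continuous_id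
  have hconj : IsClosed {x : ℝ | (x : UnitAddCircle) = (q : UnitAddCircle)} :=
    isClosed_singleton.preimage (AddCircle.continuous_mk' 1)
  have hconjInterior : interior {x : ℝ | (x : UnitAddCircle) = (q : UnitAddCircle)} = ∅ := by
    rw [interior_eq_empty_iff_dense_compl]
    refine Countable.dense_compl ℝ ((countable_range fun n : ℤ => q + (n : ℝ)).mono fun x hx => ?_)
    obtain ⟨n, rfl⟩ := coe_eq_coe_iff.1 hx
    exact mem_range_self n
  refine ⟨frontier {x | Z x = x} ∪ {x : ℝ | (x : UnitAddCircle) = (q : UnitAddCircle)},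
    ⟨isClosed_frontier.union hconj, ⟨q, Or.inr rfl⟩, fun x n => ?_⟩, ?_, ?_, subset_union_left⟩
  · exact or_congr (isIntPeriodic_frontier_fixed Z x n)
      (by rw [mem_ofPred_eq, mem_ofPred_eq, coe_add_int])
  · rw [interior_union_isClosed_of_interior_empty isClosed_frontier hconjInterior,
      interior_frontier hclosed]
  · rintro x (hx | hx)
    · exact hclosed.frontier_subset hx
    · obtain ⟨n, rfl⟩ := coe_eq_coe_iff.1 hx
      rw [map_add_int, hq]

theorem nonempty_chartSystem {Z : LineLift} {q : ℝ} (hq : Z q = q) : Nonempty (ChartSystem Z) := by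
  obtain ⟨Q, hQ, hinterior, hfix, hfrontier⟩ := exists_base hq
  have hcharts (l : ℝ) (hl : l ∈ Q) (hlr : l < gapRight Q l) :
      ∃ G e, IsTranslationChart Z l (gapRight Q l) G e :=
    exists_isTranslationChart hlr (hfix l hl) (hfix _ (hQ.gapRight_mem l))
      (disjoint_left.2 fun x hx hx' => notMem_of_mem_gap hx (hfrontier hx'))
  choose! G e hG using hcharts
  refine ⟨⟨Q, hQ, hinterior, hfix, fun l s => G (Int.fract l) s + ⌊l⌋, fun l => e (Int.fract l),
    fun l hl hlr => ?_, fun l s n => ?_⟩⟩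
  · have hfract : Int.fract l ∈ Q := by
      rwa [← hQ.periodic _ ⌊l⌋, Int.fract_add_floor]
    have hgap : gapRight Q l = gapRight Q (Int.fract l) + ⌊l⌋ := by
      rw [← hQ.gapRight_add_int, Int.fract_add_floor]
    have hfractGap : Int.fract l < gapRight Q (Int.fract l) := by
      rwa [hgap, ← sub_lt_iff_lt_add] at hlr
    simpa only [← hgap, Int.fract_add_floor] using (hG _ hfract hfractGap).add_int ⌊l⌋
  · rw [Int.fract_add_intCast, Int.floor_add_intCast, Int.cast_add, add_assoc]

end LineLift

namespace ChartSystem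

open LineLift

variable {Z : LineLift} (S : ChartSystem Z) {x : ℝ}

/-- The left endpoint of the gap containing `x`. -/
noncomputable def left (x : ℝ) : ℝ := gapLeft S.base x

/-- The coordinate of `x` in the chart of its gap. -/
noncomputable def coord (x : ℝ) : ℝ := Function.invFun (S.chart (S.left x)) x

variable {S}

theorem isTranslationChart_left (hx : x ∉ S.base) :
    IsTranslationChart Z (S.left x) (gapRight S.base (S.left x)) (S.chart (S.left x))
      (S.shift (S.left x)) :=
  S.isTranslationChart _ (S.isPeriodicClosed.gapLeft_mem x)
    ((S.isPeriodicClosed.mem_gap hx).1.trans (S.isPeriodicClosed.mem_gap hx).2)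

theorem chart_mem_gap (hx : x ∉ S.base) (s : ℝ) :
    S.chart (S.left x) s ∈ Ioo (S.left x) (gapRight S.base (S.left x)) :=
  (isTranslationChart_left hx).range_eq ▸ mem_range_self s

theorem chart_notMem (hx : x ∉ S.base) (s : ℝ) : S.chart (S.left x) s ∉ S.base :=
  notMem_of_mem_gap (chart_mem_gap hx s)

theorem left_chart (hx : x ∉ S.base) (s : ℝ) : S.left (S.chart (S.left x) s) = S.left x :=
  S.isPeriodicClosed.gapLeft_eq_of_mem_gap (S.isPeriodicClosed.gapLeft_mem x) (chart_mem_gap hx s)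

theorem chart_coord (hx : x ∉ S.base) : S.chart (S.left x) (S.coord x) = x := by
  have hrange : x ∈ range (S.chart (S.left x)) := by
    rw [(isTranslationChart_left hx).range_eq]
    exact S.isPeriodicClosed.mem_gap hx
  exact Function.invFun_eq hrange

theorem coord_chart (hx : x ∉ S.base) (s : ℝ) : S.coord (S.chart (S.left x) s) = s := by
  rw [coord, left_chart hx]
  exact Function.leftInverse_invFun (isTranslationChart_left hx).strictMono.injective s

theorem map_eq_chart (hx : x ∉ S.base) :
    Z x = S.chart (S.left x) (S.coord x + S.shift (S.left x)) := by
  rw [← (isTranslationChart_left hx).map_apply, chart_coord hx]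

theorem left_add_int (x : ℝ) (n : ℤ) : S.left (x + n) = S.left x + n :=
  S.isPeriodicClosed.gapLeft_add_int x n

theorem coord_add_int (hx : x ∉ S.base) (n : ℤ) : S.coord (x + n) = S.coord x := by
  have hxn : x + n ∉ S.base := by rwa [S.isPeriodicClosed.periodic]
  apply (isTranslationChart_left hxn).strictMono.injective
  rw [chart_coord hxn, left_add_int, S.chart_add_int, chart_coord hx]

variable (S)

open Classical in
/-- The map fixing the base and acting on each gap by a lift written in the chart of the gap. The
lifts are indexed by the classes modulo `1` of the left endpoints of the gaps. -/
noncomputable def move (κ : UnitAddCircle → LineLift) (x : ℝ) : ℝ :=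
  if x ∈ S.base then x else S.chart (S.left x) (κ (S.left x : ℝ) (S.coord x))

variable {S} {κ : UnitAddCircle → LineLift} {q : ℝ}

theorem move_of_mem (hx : x ∈ S.base) : S.move κ x = x := if_pos hx

theorem move_of_notMem (hx : x ∉ S.base) :
    S.move κ x = S.chart (S.left x) (κ (S.left x : ℝ) (S.coord x)) := if_neg hx

theorem move_chart (hx : x ∉ S.base) (s : ℝ) :
    S.move κ (S.chart (S.left x) s) = S.chart (S.left x) (κ (S.left x : ℝ) s) := by
  rw [move_of_notMem (chart_notMem hx s), left_chart hx, coord_chart hx]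

theorem le_move (hq : q ∈ S.base) (hqx : q ≤ x) : q ≤ S.move κ x := by
  by_cases hx : x ∈ S.base
  · rwa [move_of_mem hx]
  · rw [move_of_notMem hx]
    exact (le_gapLeft hq hqx).trans (chart_mem_gap hx _).1.le

theorem move_le (hq : q ∈ S.base) (hxq : x ≤ q) : S.move κ x ≤ q := by
  by_cases hx : x ∈ S.base
  · rwa [move_of_mem hx]
  · rw [move_of_notMem hx]
    exact (chart_mem_gap hx _).2.le.trans
      (gapRight_le hq ((S.isPeriodicClosed.mem_gap hx).1.trans_le hxq))

theorem monotone_move (κ : UnitAddCircle → LineLift) : Monotone (S.move κ) := by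
  intro x y hxy
  by_cases h : ∃ q ∈ S.base, x ≤ q ∧ q ≤ y
  · obtain ⟨q, hq, hxq, hqy⟩ := h
    exact (move_le hq hxq).trans (le_move hq hqy)
  · push Not at h
    have hx : x ∉ S.base := fun hx => (h x hx le_rfl).not_ge hxy
    have hy : y ∉ S.base := fun hy => (h y hy hxy).false
    obtain ⟨hlx, hxr⟩ := S.isPeriodicClosed.mem_gap hx
    have hleft : S.left y = S.left x :=
      S.isPeriodicClosed.gapLeft_eq_of_mem_gap (S.isPeriodicClosed.gapLeft_mem x)
        ⟨hlx.trans_le hxy, h _ (S.isPeriodicClosed.gapRight_mem _) hxr.le⟩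
    have hchart := (isTranslationChart_left hx).strictMono
    have hcoord : S.coord x ≤ S.coord y := by
      rwa [← hchart.le_iff_le, chart_coord hx, ← hleft, chart_coord hy]
    rw [move_of_notMem hx, move_of_notMem hy, hleft]
    exact hchart.monotone ((κ _).strictMono.monotone hcoord)

theorem move_add_one (κ : UnitAddCircle → LineLift) (x : ℝ) :
    S.move κ (x + 1) = S.move κ x + 1 := by
  rw [← Int.cast_one (R := ℝ)]
  by_cases hx : x ∈ S.base
  · rw [move_of_mem hx, move_of_mem ((S.isPeriodicClosed.periodic _ _).2 hx)]
  · have hx1 : x + (1 : ℤ) ∉ S.base := by rwa [S.isPeriodicClosed.periodic]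
    rw [move_of_notMem hx, move_of_notMem hx1, coord_add_int hx, left_add_int, coe_add_int,
      S.chart_add_int]

theorem move_one (x : ℝ) : S.move 1 x = x := by
  by_cases hx : x ∈ S.base
  · exact move_of_mem hx
  · rw [move_of_notMem hx, Pi.one_apply, Units.val_one, coe_one, id, chart_coord hx]

theorem move_mul (κ κ' : UnitAddCircle → LineLift) (x : ℝ) :
    S.move (κ * κ') x = S.move κ (S.move κ' x) := by
  by_cases hx : x ∈ S.base
  · rw [move_of_mem hx, move_of_mem hx, move_of_mem hx]
  · rw [move_of_notMem hx, move_of_notMem (κ := κ') hx, move_chart hx]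
    rfl

variable (S)

/-- The action of families of lifts through the charts. -/
noncomputable def blend : (UnitAddCircle → LineLift) →* LineLift :=
  MonoidHom.toHomUnits
    { toFun κ := ⟨⟨S.move κ, monotone_move κ⟩, move_add_one κ⟩
      map_one' := CircleDeg1Lift.ext move_one
      map_mul' κ κ' := CircleDeg1Lift.ext (move_mul κ κ') }

variable {S}

theorem blend_apply (κ : UnitAddCircle → LineLift) (x : ℝ) : S.blend κ x = S.move κ x := rfl

theorem commute_blend (κ : UnitAddCircle → LineLift) : Commute (S.blend κ) Z := by
  refine LineLift.ext fun x => ?_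
  rw [LineLift.mul_apply, LineLift.mul_apply, blend_apply, blend_apply]
  by_cases hx : x ∈ S.base
  · rw [S.map_eq x hx, move_of_mem hx, S.map_eq x hx]
  · rw [map_eq_chart hx, move_chart hx, move_of_notMem hx, (isTranslationChart_left hx).map_apply,
      map_add_int]

theorem pointwiseContinuous_blend {Y : Type*} [TopologicalSpace Y]
    {κ : Y → UnitAddCircle → LineLift} (h : ∀ c, PointwiseContinuous fun s => κ s c) :
    PointwiseContinuous fun s => S.blend (κ s) := by
  intro x
  simp only [blend_apply]
  by_cases hx : x ∈ S.base
  · simp only [move_of_mem hx, continuous_const]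
  · simp only [move_of_notMem hx]
    exact (isTranslationChart_left hx).isOpenEmbedding.continuous.comp (h _ _)

end ChartSystem

/-! ### Displacement along paths in a centralizer -/

namespace LineLift

/-- The lift `C` is joined to the identity by a path in the centralizer of `Z`. -/
def JoinedInCentralizer (Z C : LineLift) : Prop :=
  ∃ δ : unitInterval → LineLift,
    PointwiseContinuous δ ∧ δ 0 = 1 ∧ δ 1 = C ∧ ∀ s, Commute (δ s) Z

theorem PointwiseContinuous.eventually_abs_sub_lt {Y : Type*} [TopologicalSpace Y]
    {G : Y → LineLift} (hG : PointwiseContinuous G) {s₀ : Y} (hs₀ : G s₀ = 1) {ε : ℝ}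
    (hε : 0 < ε) : ∀ᶠ s in 𝓝 s₀, ∀ x, |G s x - x| < ε := by
  have hlocal : ∀ᶠ s in 𝓝 s₀, ∀ x ∈ Icc (0 : ℝ) 1, |G s x - x| < ε := by
    refine isCompact_Icc.eventually_forall_of_forall_eventually fun x _ => ?_
    have hcont : Continuous fun p : Y × ℝ => |G p.1 p.2 - p.2| :=
      (hG.uncurry.sub continuous_snd).abs
    exact hcont.continuousAt.eventually_lt continuousAt_const (by simpa [hs₀] using hε)
  filter_upwards [hlocal] with s hs x
  have hx := hs (Int.fract x) ⟨Int.fract_nonneg x, (Int.fract_lt_one x).le⟩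
  rwa [CircleDeg1Lift.map_fract_sub_fract_eq] at hx

end LineLift

namespace ChartSystem

open LineLift

variable {Z : LineLift} (S : ChartSystem Z) {x : ℝ}

/-- A one-parameter group in the centralizer of `Z` that moves all points of the gaps upwards. -/
noncomputable def flow (t : ℝ) : LineLift :=
  S.blend fun _ => translate (Multiplicative.ofAdd t)

variable {S}

theorem flow_zero : S.flow 0 = 1 := by
  rw [flow, ofAdd_zero, map_one]
  exact map_one S.blend

theorem pointwiseContinuous_flow : PointwiseContinuous S.flow := by
  refine pointwiseContinuous_blend fun _ x => ?_
  simp only [translate_apply]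
  fun_prop

theorem joinedInCentralizer_flow (t : ℝ) : JoinedInCentralizer Z (S.flow t) :=
  ⟨fun s => S.flow (s * t), fun x => (pointwiseContinuous_flow x).comp (by fun_prop),
    by simp only [Icc.coe_zero, zero_mul, flow_zero], by simp only [Icc.coe_one, one_mul],
    fun _ => commute_blend _⟩

theorem flow_apply_lt_flow_apply (hx : x ∉ S.base) {t t' : ℝ} (h : t < t') :
    S.flow t x < S.flow t' x := by
  simp only [flow, blend_apply, move_of_notMem hx, translate_apply]
  exact (isTranslationChart_left hx).strictMono (by gcongr)

theorem flow_le_flow {t t' : ℝ} (h : t ≤ t') :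
    (S.flow t : CircleDeg1Lift) ≤ (S.flow t' : CircleDeg1Lift) := by
  intro x
  by_cases hx : x ∈ S.base
  · rw [flow, flow, blend_apply, blend_apply, move_of_mem hx, move_of_mem hx]
  · exact h.eq_or_lt.elim (fun h => h ▸ le_rfl) fun h => (flow_apply_lt_flow_apply hx h).le

theorem flow_mul_pow_apply_lt {A : LineLift} {n : ℕ} (hn : n ≠ 0) {y : ℝ} (hy : A y ∉ S.base)
    {t t' : ℝ} (h : t < t') : ((S.flow t * A) ^ n) y < ((S.flow t' * A) ^ n) y := by
  obtain ⟨k, rfl⟩ := Nat.exists_eq_succ_of_ne_zero hn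
  have hle : ((S.flow t * A : LineLift) : CircleDeg1Lift) ≤ (S.flow t' * A : LineLift) :=
    fun x => flow_le_flow h.le (A x)
  calc ((S.flow t * A) ^ (k + 1)) y = ((S.flow t * A) ^ k) (S.flow t (A y)) := by
        rw [pow_succ]; rfl
    _ < ((S.flow t * A) ^ k) (S.flow t' (A y)) :=
        ((S.flow t * A) ^ k).strictMono (flow_apply_lt_flow_apply hy h)
    _ ≤ ((S.flow t' * A) ^ k) (S.flow t' (A y)) := by
        simpa only [Units.val_pow_eq_pow_val] using pow_mono hle k (S.flow t' (A y))
    _ = ((S.flow t' * A) ^ (k + 1)) y := by rw [pow_succ]; rfl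

theorem disjoint_interior_flow_periodic (A : LineLift) {n : ℕ} (hn : n ≠ 0) (m : ℝ) {t t' : ℝ}
    (h : t < t') : Disjoint (interior {y : ℝ | ((S.flow t * A) ^ n) y = y + m})
      (interior {y : ℝ | ((S.flow t' * A) ^ n) y = y + m}) := by
  have hdense : Dense (A ⁻¹' S.base : Set ℝ)ᶜ := by
    rw [← interior_eq_empty_iff_dense_compl, ← coe_toOrderIso, ← OrderIso.coe_toHomeomorph,
      ← Homeomorph.preimage_interior, S.interior_base, preimage_empty]
  rw [disjoint_iff_inter_eq_empty, ← not_nonempty_iff_eq_empty]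
  intro hmeet
  obtain ⟨y, ⟨hy, hy'⟩, hAy⟩ :=
    hdense.inter_open_nonempty _ (isOpen_interior.inter isOpen_interior) hmeet
  exact (flow_mul_pow_apply_lt hn hAy h).ne ((interior_subset hy).trans (interior_subset hy').symm)

theorem countable_nonempty_interior_flow_periodic (A : LineLift) {n : ℕ} (hn : n ≠ 0) (m : ℝ) :
    {t : ℝ | (interior {y : ℝ | ((S.flow t * A) ^ n) y = y + m}).Nonempty}.Countable := by
  refine PairwiseDisjoint.countable_of_isOpen (fun t _ t' _ hne => ?_)
    (fun _ _ => isOpen_interior) fun _ ht => ht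
  rcases hne.lt_or_gt with h | h
  · exact disjoint_interior_flow_periodic A hn m h
  · exact (disjoint_interior_flow_periodic A hn m h).symm

end ChartSystem

namespace LineLift

theorem exists_joinedInCentralizer_interior_periodic_eq_empty {Z : LineLift} {q : ℝ} (hq : Z q = q)
    (T : LineLift) {n : ℕ} (hn : n ≠ 0) (m : ℝ) {ε : ℝ} (hε : 0 < ε) :
    ∃ C, JoinedInCentralizer Z C ∧ (∀ y, |C y - y| < ε) ∧
      interior {y : ℝ | ((C * T) ^ n) y = y + m} = ∅ := by
  obtain ⟨S⟩ := nonempty_chartSystem hq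
  obtain ⟨t, hempty, hsmall⟩ :=
    ((S.countable_nonempty_interior_flow_periodic T hn m).dense_compl ℝ).exists_mem_open
      isOpen_interior ⟨0, mem_interior_iff_mem_nhds.2
        (ChartSystem.pointwiseContinuous_flow.eventually_abs_sub_lt ChartSystem.flow_zero hε)⟩
  exact ⟨S.flow t, ChartSystem.joinedInCentralizer_flow t, interior_subset hsmall,
    not_nonempty_iff_eq_empty.1 hempty⟩

end LineLift

/-! ### Squeezing inside a centralizer -/

namespace LineLift

theorem exists_forall_apply_eq {f : ℝ → ℝ} (hf : StrictMono f) (hcont : Continuous f)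
    (hone : ∀ x, f (x + 1) = f x + 1) : ∃ F : LineLift, ∀ x, F x = f x := by
  let F : CircleDeg1Lift := ⟨⟨f, hf.monotone⟩, hone⟩
  have hF : IsUnit F :=
    isUnit_iff_bijective.2 ⟨hf.injective, F.continuous_iff_surjective.1 hcont⟩
  exact ⟨hF.unit, fun _ => rfl⟩

theorem exists_pointwiseContinuous_joining_one (F : LineLift) :
    ∃ κ : unitInterval → LineLift, PointwiseContinuous κ ∧ κ 0 = 1 ∧ κ 1 = F := by
  have hsegment (s : unitInterval) :
      ∃ G : LineLift, ∀ x : ℝ, G x = (1 - s) * x + s * F x := by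
    refine exists_forall_apply_eq (fun x y hxy => ?_)
      ((continuous_const.mul continuous_id).add (continuous_const.mul F.continuous)) fun x => ?_
    · have hF := F.strictMono hxy
      rcases s.2.1.eq_or_lt with hs | hs
      · simpa only [← hs, sub_zero, one_mul, zero_mul, add_zero] using hxy
      · nlinarith [mul_nonneg (sub_nonneg.2 s.2.2) (sub_nonneg.2 hxy.le)]
    · rw [map_add_one]
      ring
  choose κ hκ using hsegment
  refine ⟨κ, fun x => ?_, LineLift.ext fun x => ?_, LineLift.ext fun x => ?_⟩
  · simp only [hκ]
    fun_prop
  · simp [hκ]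
  · simp [hκ]

theorem exists_apply_eq_floor_add {f : ℝ → ℝ} (hf : StrictMono f) (hcont : Continuous f)
    (h₀ : f 0 = 0) (h₁ : f 1 = 1) :
    ∃ F : LineLift, ∀ x : ℝ, F x = ⌊x⌋ + f (Int.fract x) := by
  refine exists_forall_apply_eq (fun x y hxy => ?_) ?_ fun x => ?_
  · rcases (Int.floor_mono hxy.le).eq_or_lt with heq | hlt
    · rw [heq]
      gcongr
      apply hf
      rw [Int.fract, Int.fract, heq]
      gcongr
    · have hx : f (Int.fract x) < 1 := h₁ ▸ hf (Int.fract_lt_one x)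
      have hy : 0 ≤ f (Int.fract y) := h₀ ▸ hf.monotone (Int.fract_nonneg y)
      have hfloor : (⌊x⌋ : ℝ) + 1 ≤ ⌊y⌋ := by exact_mod_cast hlt
      linarith
  · have hdefect : Continuous fun x => f (Int.fract x) - Int.fract x :=
      ContinuousOn.comp_fract'' (f := fun u => f u - u) (hcont.sub continuous_id).continuousOn
        (by rw [h₀, h₁, sub_zero, sub_self])
    refine (continuous_id.add hdefect).congr fun x => ?_
    change x + (f (Int.fract x) - Int.fract x) = ⌊x⌋ + f (Int.fract x)
    linarith [Int.self_sub_fract x]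
  · rw [Int.floor_add_one, Int.fract_add_one]
    push_cast
    ring

theorem exists_crushing {r r' : ℝ} (hr : 0 < r) (hr' : 0 < r') :
    ∃ F : LineLift, (∀ x : ℝ, ⌊x⌋ ≤ F x ∧ F x ≤ x) ∧
      ∀ x : ℝ, Int.fract x ≤ 1 - r → F x < ⌊x⌋ + r' := by
  let c : ℝ := min (r' / 2) 1
  let K : ℝ := max 1 r⁻¹
  have hc : 0 < c := by positivity
  have hc₁ : c ≤ 1 := min_le_right _ _
  have hcr : c < r' := (min_le_left _ _).trans_lt (half_lt_self hr')
  have hK : 1 ≤ K := le_max_left _ _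
  have hKr : 1 ≤ K * r := by
    rw [← inv_mul_cancel₀ hr.ne']
    gcongr
    exact le_max_right _ _
  obtain ⟨F, hF⟩ := exists_apply_eq_floor_add (f := fun u => max (c * u) (1 - K * (1 - u)))
    (fun u v huv => max_lt_max (by gcongr) (by gcongr)) (by fun_prop) (by simp [hK]) (by simp [hc₁])
  refine ⟨F, fun x => ?_, fun x hx => ?_⟩ <;> rw [hF]
  · have hu := Int.fract_nonneg x
    have hu₁ := Int.fract_lt_one x
    refine ⟨le_add_of_nonneg_right (le_max_of_le_left (by positivity)), ?_⟩
    rw [← le_sub_iff_add_le', Int.self_sub_floor]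
    exact max_le (mul_le_of_le_one_left hu hc₁) (by nlinarith)
  · gcongr
    refine max_lt ?_ ?_
    · nlinarith [Int.fract_lt_one x]
    · nlinarith

theorem exists_displacement_avoiding {P Q : Set UnitAddCircle} (hP : IsClosed P)
    (hQ : IsClosed Q) (hPuniv : P ≠ univ) (hQuniv : Q ≠ univ) :
    ∃ κ : LineLift, (∀ x : ℝ, |κ x - x| ≤ 1) ∧
      ∀ x : ℝ, (x : UnitAddCircle) ∈ P → ((κ x : ℝ) : UnitAddCircle) ∉ Q := by
  have hball {P : Set UnitAddCircle} (hP : IsClosed P) (hPuniv : P ≠ univ) :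
      ∃ θ r : ℝ, 0 < r ∧ ∀ z ∈ P, r ≤ dist z θ := by
    obtain ⟨z, hz⟩ := (ne_univ_iff_exists_notMem P).1 hPuniv
    obtain ⟨θ, rfl⟩ := QuotientAddGroup.mk_surjective z
    obtain ⟨r, hr, hball⟩ := Metric.isOpen_iff.1 hP.isOpen_compl _ hz
    exact ⟨θ, r, hr, fun z hzP => not_lt.1 fun hlt => hball hlt hzP⟩
  obtain ⟨θ, r, hr, hθ⟩ := hball hP hPuniv
  obtain ⟨g, r', hr', hg⟩ := hball hQ hQuniv
  obtain ⟨F, hF, hcrush⟩ := exists_crushing hr hr'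
  obtain ⟨κ, hκ⟩ : ∃ κ : LineLift, ∀ x : ℝ, κ x = F (x - θ) + (θ + Int.fract (g - θ)) :=
    exists_forall_apply_eq (fun x y hxy => by gcongr; exact F.strictMono (by gcongr))
      ((F.continuous.comp (continuous_id.sub continuous_const)).add continuous_const) fun x => by
        rw [add_sub_right_comm, map_add_one]
        ring
  refine ⟨κ, fun x => ?_, fun x hx hκx => ?_⟩
  · obtain ⟨hlower, hupper⟩ := hF (x - θ)
    have hg₀ := Int.fract_nonneg (g - θ)
    have hg₁ := Int.fract_lt_one (g - θ)
    have hfloor := Int.sub_one_lt_floor (x - θ)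
    rw [hκ, abs_le]
    constructor <;> linarith
  · have hfract : Int.fract (x - θ) ≤ 1 - r := by
      have hdist := hθ _ hx
      rw [dist_eq_norm, ← AddCircle.coe_sub, UnitAddCircle.norm_eq, abs_sub_round_eq_min] at hdist
      linarith [min_le_right (Int.fract (x - θ)) (1 - Int.fract (x - θ))]
    refine (hg _ hκx).not_gt ?_
    have hcoe : ((κ x - g : ℝ) : UnitAddCircle) = ((F (x - θ) - ⌊x - θ⌋ : ℝ) : UnitAddCircle) :=
      coe_eq_coe_iff.2 ⟨⌊x - θ⌋ - ⌊g - θ⌋, by rw [hκ, Int.fract]; push_cast; ring⟩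
    rw [dist_eq_norm, ← AddCircle.coe_sub, hcoe]
    refine (QuotientAddGroup.norm_mk_le_norm).trans_lt ?_
    rw [Real.norm_of_nonneg (sub_nonneg.2 (hF _).1), sub_lt_iff_lt_add']
    exact hcrush _ hfract

theorem image_coe_ne_univ {A : Set ℝ} (hA : IsClosed A) (hinterior : interior A = ∅) (B : Set ℝ) :
    (fun x : ℝ => (x : UnitAddCircle)) '' (A ∩ B) ≠ univ := by
  intro huniv
  obtain ⟨n, x, hx⟩ := nonempty_interior_of_iUnion_of_closed
    (f := fun n : ℤ => Homeomorph.addRight (n : ℝ) ⁻¹' A)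
    (fun n => hA.preimage (Homeomorph.continuous _)) (eq_univ_of_forall fun x => by
      obtain ⟨y, hy, hyx⟩ := huniv.symm ▸ mem_univ (x : UnitAddCircle)
      obtain ⟨n, rfl⟩ := coe_eq_coe_iff.1 hyx
      exact mem_iUnion.2 ⟨n, hy.1⟩)
  rw [← Homeomorph.preimage_interior, hinterior] at hx
  exact hx

end LineLift

namespace ChartSystem

open LineLift

variable {Z : LineLift} {S : ChartSystem Z}

theorem exists_abs_coord_div_le {N : ℕ} (hN : N ≠ 0) :
    ∃ M : ℝ, ∀ j : ℤ, (j / N : ℝ) ∉ S.base → |S.coord (j / N)| ≤ M := by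
  obtain ⟨M, hM⟩ := ((Set.finite_Ico 0 (N : ℤ)).image fun j : ℤ => |S.coord (j / N)|).bddAbove
  refine ⟨M, fun j hj => ?_⟩
  have hsplit : (j / N : ℝ) = (j % N : ℤ) / N + (j / N : ℤ) := by
    have hmod : (j : ℝ) = (j % N : ℤ) + N * (j / N : ℤ) := by
      exact_mod_cast (Int.emod_add_mul_ediv j N).symm
    rw [div_add' _ _ _ (Nat.cast_ne_zero.2 hN), mul_comm, ← hmod]
  rw [hsplit, S.isPeriodicClosed.periodic] at hj
  rw [hsplit, coord_add_int hj]
  have hN' : (0 : ℤ) < N := by positivity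
  exact hM (mem_image_of_mem _ ⟨Int.emod_nonneg _ hN'.ne', Int.emod_lt_of_pos _ hN'⟩)

theorem exists_forall_chart_sub_chart_lt {ε : ℝ} (hε : 0 < ε) :
    ∃ M : ℝ, ∀ x ∉ S.base, ∀ s : ℝ, M < |s| →
      S.chart (S.left x) (s + 1) - S.chart (S.left x) (s - 1) < ε := by
  obtain ⟨N, hN⟩ := exists_nat_gt (1 / ε)
  have hN₀ : (0 : ℝ) < N := (by positivity : (0 : ℝ) < 1 / ε).trans hN
  rw [div_lt_iff₀ hε] at hN
  obtain ⟨M, hM⟩ := S.exists_abs_coord_div_le (Nat.cast_pos.1 hN₀).ne'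
  refine ⟨M + 1, fun x hx s hs => not_le.1 fun hlong => ?_⟩
  obtain ⟨j, hleft, hright⟩ : ∃ j : ℤ, S.chart (S.left x) (s - 1) ≤ j / N ∧
      (j / N : ℝ) ≤ S.chart (S.left x) (s + 1) := by
    refine ⟨⌈S.chart (S.left x) (s - 1) * N⌉, (le_div_iff₀ hN₀).2 (Int.le_ceil _), ?_⟩
    rw [div_le_iff₀ hN₀]
    nlinarith [Int.ceil_lt_add_one (S.chart (S.left x) (s - 1) * N)]
  have hgap : (j / N : ℝ) ∈ Ioo (S.left x) (gapRight S.base (S.left x)) :=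
    ⟨(chart_mem_gap hx _).1.trans_le hleft, hright.trans_lt (chart_mem_gap hx _).2⟩
  obtain ⟨t, ht⟩ : (j / N : ℝ) ∈ range (S.chart (S.left x)) :=
    (isTranslationChart_left hx).range_eq ▸ hgap
  have htM := hM j (notMem_of_mem_gap hgap)
  rw [← ht, coord_chart hx, abs_le] at htM
  rw [← ht, (isTranslationChart_left hx).strictMono.le_iff_le] at hleft hright
  rcases lt_abs.1 hs with hs | hs <;> linarith

theorem exists_chart_displacement_avoiding {K₁ K₂ : Set ℝ} (h₁ : IsClosed K₁)
    (h₁per : IsIntPeriodic K₁) (h₁int : interior K₁ = ∅) (h₂ : IsClosed K₂)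
    (h₂per : IsIntPeriodic K₂) (h₂int : interior K₂ = ∅) (M : ℝ) (c : UnitAddCircle) :
    ∃ κ : LineLift, (∀ s : ℝ, |κ s - s| ≤ 1) ∧
      ∀ x ∉ S.base, (S.left x : UnitAddCircle) = c → ∀ s : ℝ, |s| ≤ M →
        S.chart (S.left x) s ∈ K₁ → S.chart (S.left x) (κ s) ∉ K₂ := by
  by_cases hc : ∃ x ∉ S.base, (S.left x : UnitAddCircle) = c
  swap
  · exact ⟨1, fun s => by simp, fun x hx hxc => absurd ⟨x, hx, hxc⟩ hc⟩
  obtain ⟨x, hx, rfl⟩ := hc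
  have hembedding := (isTranslationChart_left hx).isOpenEmbedding
  have hpreimage {K : Set ℝ} (hK : interior K = ∅) :
      interior (S.chart (S.left x) ⁻¹' K) = ∅ := by
    rw [← hembedding.isOpenMap.preimage_interior_eq_interior_preimage hembedding.continuous, hK,
      preimage_empty]
  have hclosed {K : Set ℝ} (hK : IsClosed K) (R : ℝ) : IsClosed
      ((fun s : ℝ => (s : UnitAddCircle)) '' (S.chart (S.left x) ⁻¹' K ∩ Icc (-R) R)) :=
    ((isCompact_Icc.inter_left (hK.preimage hembedding.continuous)).image
      (AddCircle.continuous_mk' 1)).isClosed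
  obtain ⟨κ, hκ, havoid⟩ := exists_displacement_avoiding (hclosed h₁ M) (hclosed h₂ (M + 1))
    (image_coe_ne_univ (h₁.preimage hembedding.continuous) (hpreimage h₁int) _)
    (image_coe_ne_univ (h₂.preimage hembedding.continuous) (hpreimage h₂int) _)
  refine ⟨κ, hκ, fun y _ hyx s hs hs₁ hs₂ => ?_⟩
  obtain ⟨n, hn⟩ := coe_eq_coe_iff.1 hyx
  rw [hn, S.chart_add_int] at hs₁ hs₂
  have hκs : |κ s| ≤ M + 1 := by
    linarith [abs_sub_abs_le_abs_sub (κ s) s, hκ s]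
  exact havoid s (mem_image_of_mem _ ⟨(h₁per _ _).1 hs₁, abs_le.1 hs⟩)
    (mem_image_of_mem _ ⟨(h₂per _ _).1 hs₂, abs_le.1 hκs⟩)

theorem abs_chart_sub_lt {x ε t : ℝ} (hx : x ∉ S.base)
    (hshort : S.chart (S.left x) (S.coord x + 1) - S.chart (S.left x) (S.coord x - 1) < ε)
    (ht : |t - S.coord x| ≤ 1) : |S.chart (S.left x) t - x| < ε := by
  have hmono := (isTranslationChart_left hx).strictMono.monotone
  rw [abs_le] at ht
  have htupper := hmono (show t ≤ S.coord x + 1 by linarith)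
  have htlower := hmono (show S.coord x - 1 ≤ t by linarith)
  have hxupper := hmono (show S.coord x ≤ S.coord x + 1 by linarith)
  have hxlower := hmono (show S.coord x - 1 ≤ S.coord x by linarith)
  rw [chart_coord hx] at hxupper hxlower
  rw [abs_lt]
  constructor <;> linarith

end ChartSystem

/-- Points of `K₁` far out in the charts are squeezed by both `C` and `Z`; the others are moved
off `K₂` by a displacement of bounded size in the charts. -/
theorem LineLift.exists_joinedInCentralizer_squeeze {Z : LineLift} {q : ℝ} (hq : Z q = q)
    {K₁ K₂ : Set ℝ} (h₁ : IsClosed K₁) (h₁per : IsIntPeriodic K₁) (h₁int : interior K₁ = ∅)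
    (h₂ : IsClosed K₂) (h₂per : IsIntPeriodic K₂) (h₂int : interior K₂ = ∅) {ε : ℝ}
    (hε : 0 < ε) :
    ∃ C, JoinedInCentralizer Z C ∧ ∀ y ∈ K₁, C y ∈ K₂ → |C y - y| < ε ∧ |Z y - y| < ε := by
  obtain ⟨S⟩ := nonempty_chartSystem hq
  obtain ⟨M, hM⟩ := S.exists_forall_chart_sub_chart_lt hε
  choose κ hκ havoid using
    S.exists_chart_displacement_avoiding h₁ h₁per h₁int h₂ h₂per h₂int M
  choose γ hγ hγ₀ hγ₁ using fun c => exists_pointwiseContinuous_joining_one (κ c)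
  refine ⟨S.blend κ, ⟨fun s => S.blend fun c => γ c s, ChartSystem.pointwiseContinuous_blend hγ,
    ?_, ?_, fun s => ChartSystem.commute_blend _⟩, fun y hy₁ hy₂ => ?_⟩
  · exact (congrArg S.blend (funext hγ₀)).trans (map_one S.blend)
  · exact congrArg S.blend (funext hγ₁)
  · rw [ChartSystem.blend_apply] at hy₂ ⊢
    by_cases hy : y ∈ S.base
    · rw [ChartSystem.move_of_mem hy, S.map_eq y hy, sub_self, abs_zero]
      exact ⟨hε, hε⟩
    rw [ChartSystem.move_of_notMem hy] at hy₂ ⊢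
    have hfar : M < |S.coord y| := not_le.1 fun hle =>
      havoid _ y hy rfl _ hle (by rwa [ChartSystem.chart_coord hy]) hy₂
    have hshift := (ChartSystem.isTranslationChart_left hy).abs_shift_le
    rw [ChartSystem.map_eq_chart hy]
    refine ⟨ChartSystem.abs_chart_sub_lt hy (hM y hy _ hfar) (hκ _ _),
      ChartSystem.abs_chart_sub_lt hy (hM y hy _ hfar) ?_⟩
    rw [add_sub_cancel_left]
    exact_mod_cast hshift

/-! ### Finite orbits -/

/-- The preimage in the line of a finite nonempty subset of the circle. -/
structure IsPeriodicFinite (X : Set ℝ) : Prop where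
  nonempty : X.Nonempty
  isIntPeriodic : IsIntPeriodic X
  finite : ((fun x : ℝ => (x : UnitAddCircle)) '' X).Finite

/-- The increasing enumeration `ι` by the integers of a set with `N` points in each fundamental
domain of the translation by one. -/
structure IsEnumeration (X : Set ℝ) (N : ℕ) (ι : ℤ → ℝ) : Prop where
  pos : 0 < N
  strictMono : StrictMono ι
  range_eq : range ι = X
  apply_add : ∀ k, ι (k + N) = ι k + 1

theorem exists_forall_eq_add_of_strictMono {f : ℤ → ℤ} (hf : StrictMono f) {N : ℤ} (hN : 0 < N)
    (hper : ∀ k, f (k + N) = f k + N) : ∃ c, ∀ k, f k = k + c := by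
  have hmono : Monotone fun k => f k - k :=
    monotone_int_of_le_succ fun k => by have := hf (lt_add_one k); lia
  have hperiodic : Function.Periodic (fun k => f k - k) N := fun k => by simp only [hper]; ring
  refine ⟨f 0, fun k => ?_⟩
  obtain ⟨l, ⟨hl, hlN⟩, heq⟩ := hperiodic.exists_mem_Ico₀ hN k
  have hl₀ : f 0 - 0 ≤ f l - l := hmono hl
  have hlN : f l - l ≤ f N - N := hmono hlN.le
  have hN : f N - N = f 0 - 0 := by simpa using hperiodic 0
  lia

namespace IsPeriodicFinite

variable {X : Set ℝ}

theorem add_int_mem (hX : IsPeriodicFinite X) {x : ℝ} (hx : x ∈ X) (n : ℤ) : x + n ∈ X :=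
  (hX.isIntPeriodic x n).2 hx

theorem image (hX : IsPeriodicFinite X) {η : ℝ → ℝ}
    (hη : ∀ (x : ℝ) (n : ℤ), η (x + n) = η x + n) : IsPeriodicFinite (η '' X) where
  nonempty := hX.nonempty.image η
  isIntPeriodic := by
    have h : ∀ y ∈ η '' X, ∀ n : ℤ, y + n ∈ η '' X := by
      rintro _ ⟨x, hx, rfl⟩ n
      exact ⟨x + n, hX.add_int_mem hx n, hη x n⟩
    exact fun y n => ⟨fun hy => by simpa using h _ hy (-n), fun hy => h y hy n⟩
  finite := by
    refine (hX.finite.image fun z => (η z.out : UnitAddCircle)).subset ?_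
    rintro _ ⟨_, ⟨x, hx, rfl⟩, rfl⟩
    refine ⟨x, mem_image_of_mem _ hx, ?_⟩
    obtain ⟨n, hn⟩ := LineLift.coe_eq_coe_iff.1 (Quotient.out_eq (x : UnitAddCircle))
    simp only [hn, hη, LineLift.coe_add_int]

theorem finite_inter_Icc (hX : IsPeriodicFinite X) (a b : ℝ) : (X ∩ Icc a b).Finite := by
  have hinj : InjOn (fun x : ℝ => (x : UnitAddCircle)) (Ico 0 (0 + 1)) := fun x hx y hy =>
    (AddCircle.coe_eq_coe_iff_of_mem_Ico hx hy).1
  have hfin : (X ∩ Ico 0 (0 + 1)).Finite :=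
    (hX.finite.subset (image_mono inter_subset_left)).of_finite_image
      (hinj.mono inter_subset_right)
  refine ((finite_Icc ⌊a⌋ ⌊b⌋).biUnion fun k _ => hfin.image (· + (k : ℝ))).subset ?_
  rintro x ⟨hx, hax, hxb⟩
  refine mem_biUnion (x := ⌊x⌋) ⟨Int.floor_mono hax, Int.floor_mono hxb⟩
    ⟨Int.fract x, ⟨?_, Int.fract_nonneg x, by simpa using Int.fract_lt_one x⟩,
      Int.fract_add_floor x⟩
  rw [← hX.isIntPeriodic _ ⌊x⌋, Int.fract_add_floor]
  exact hx

theorem nonempty_orderIso_int (hX : IsPeriodicFinite X) : Nonempty (X ≃o ℤ) := by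
  classical
  have hfin (a b : X) : (Icc a b).Finite :=
    Finite.of_finite_image ((hX.finite_inter_Icc a b).subset (by
      rintro _ ⟨x, hx, rfl⟩
      exact ⟨x.2, hx⟩)) Subtype.val_injective.injOn
  let : LocallyFiniteOrder X := LocallyFiniteOrder.ofFiniteIcc hfin
  let : SuccOrder X := LinearLocallyFiniteOrder.succOrder X
  let : PredOrder X := LinearLocallyFiniteOrder.predOrder X
  have : Nonempty X := hX.nonempty.to_subtype
  have : NoMaxOrder X := ⟨fun x => ⟨⟨x + (1 : ℤ), hX.add_int_mem x.2 1⟩,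
    Subtype.mk_lt_mk.2 (by simp)⟩⟩
  have : NoMinOrder X := ⟨fun x => ⟨⟨x + (-1 : ℤ), hX.add_int_mem x.2 (-1)⟩,
    Subtype.mk_lt_mk.2 (by simp)⟩⟩
  exact ⟨orderIsoIntOfLinearSuccPredArch⟩

theorem exists_isEnumeration (hX : IsPeriodicFinite X) : ∃ N ι, IsEnumeration X N ι := by
  obtain ⟨e⟩ := hX.nonempty_orderIso_int
  let shift (n : ℤ) (x : X) : X := ⟨x + n, hX.add_int_mem x.2 n⟩
  let T : ℤ ≃o ℤ := e.symm.trans (OrderIso.trans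
    { toFun := shift 1
      invFun := shift (-1)
      left_inv := fun x => by simp [shift]
      right_inv := fun x => by simp [shift]
      map_rel_iff' := by simp [shift] } e)
  have hT (k : ℤ) : (e.symm (T k) : ℝ) = e.symm k + 1 := by simp [T, shift]
  obtain ⟨c, hc⟩ := exists_forall_eq_add_of_strictMono T.strictMono one_pos
    fun k => by simpa using T.map_succ k
  have hmono : StrictMono fun k => (e.symm k : ℝ) := fun j k h => e.symm.strictMono h
  have hc₀ : 0 < c := by
    have : (e.symm 0 : ℝ) < e.symm (0 + c) := by rw [← hc, hT]; exact lt_add_one _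
    simpa using hmono.lt_iff_lt.1 this
  refine ⟨c.toNat, fun k => e.symm k, by lia, hmono, ?_, fun k => ?_⟩
  · ext x
    exact ⟨fun ⟨k, hk⟩ => hk ▸ (e.symm k).2, fun hx => ⟨e ⟨x, hx⟩, by simp⟩⟩
  · simpa only [Int.toNat_of_nonneg hc₀.le, ← hc] using hT k

end IsPeriodicFinite

namespace IsEnumeration

variable {X : Set ℝ} {N : ℕ} {ι : ℤ → ℝ} {F G : LineLift}

theorem apply_mem (h : IsEnumeration X N ι) (k : ℤ) : ι k ∈ X := h.range_eq ▸ mem_range_self k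

theorem apply_add_mul (h : IsEnumeration X N ι) (k n : ℤ) : ι (k + n * N) = ι k + n := by
  induction n using Int.induction_on with
  | zero => simp
  | succ n ih => rw [add_one_mul, ← add_assoc, h.apply_add, ih]; push_cast; ring
  | pred n ih =>
    have := h.apply_add (k + (-n - 1) * N)
    rw [show k + (-(n : ℤ) - 1) * N + N = k + -n * N by ring, ih] at this
    push_cast at this ⊢
    linarith

theorem exists_shift (h : IsEnumeration X N ι) (hF : MapsTo F X X) :
    ∃ c : ℤ, ∀ k, F (ι k) = ι (k + c) := by
  obtain ⟨hN, hι, rfl, hper⟩ := h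
  choose f hf using fun k => hF (mem_range_self k)
  obtain ⟨c, hc⟩ := exists_forall_eq_add_of_strictMono (f := f) (N := N)
    (fun j k h => hι.lt_iff_lt.1 (by rw [hf, hf]; exact F.strictMono (hι h))) (by lia)
    fun k => hι.injective (by rw [hf, hper, hper, hf, map_add_one])
  exact ⟨c, fun k => by rw [← hf, hc]⟩

theorem pow_apply {c : ℤ} (hF : ∀ k, F (ι k) = ι (k + c)) (n : ℕ) (k : ℤ) :
    (F ^ n) (ι k) = ι (k + c * n) := by
  induction n with
  | zero => simp
  | succ n ih =>
    rw [pow_succ', LineLift.mul_apply, ih, hF]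
    push_cast
    ring_nf

theorem pow_period_apply (h : IsEnumeration X N ι) {c : ℤ} (hF : ∀ k, F (ι k) = ι (k + c))
    (k : ℤ) : (F ^ N) (ι k) = ι k + c := by
  rw [pow_apply hF, h.apply_add_mul]

theorem translationNumber_eq (h : IsEnumeration X N ι) {c : ℤ} (hF : ∀ k, F (ι k) = ι (k + c)) :
    translationNumber F = c / N :=
  translationNumber_of_map_pow_eq_add_int _ (by simpa using h.pow_period_apply hF 0) h.pos

end IsEnumeration

namespace IsPeriodicFinite

variable {X : Set ℝ} {F G : LineLift}

theorem exists_period (hX : IsPeriodicFinite X) : ∃ n : ℕ, n ≠ 0 ∧ ∀ F : LineLift,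
    MapsTo F X X → ∃ m : ℤ, (m : ℝ) = n * translationNumber F ∧ ∀ x ∈ X, (F ^ n) x = x + m := by
  obtain ⟨N, ι, h⟩ := hX.exists_isEnumeration
  refine ⟨N, h.pos.ne', fun F hF => ?_⟩
  obtain ⟨c, hc⟩ := h.exists_shift hF
  refine ⟨c, ?_, fun x hx => ?_⟩
  · rw [h.translationNumber_eq hc, mul_div_cancel₀ _ (Nat.cast_ne_zero.2 h.pos.ne')]
  · obtain ⟨k, rfl⟩ := h.range_eq ▸ hx
    exact h.pow_period_apply hc k

theorem mapsTo_inv (hX : IsPeriodicFinite X) (hF : MapsTo F X X) : MapsTo ↑F⁻¹ X X := by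
  obtain ⟨N, ι, h⟩ := hX.exists_isEnumeration
  obtain ⟨c, hc⟩ := h.exists_shift hF
  intro x hx
  obtain ⟨k, rfl⟩ := h.range_eq ▸ hx
  have hk : F⁻¹ (ι k) = ι (k - c) := F.inv_apply_eq_iff.2 (by rw [hc, sub_add_cancel])
  exact hk ▸ h.apply_mem _

theorem translationNumber_mul (hX : IsPeriodicFinite X) (hF : MapsTo F X X) (hG : MapsTo G X X) :
    translationNumber (F * G : LineLift) = translationNumber F + translationNumber G := by
  obtain ⟨N, ι, h⟩ := hX.exists_isEnumeration
  obtain ⟨c, hc⟩ := h.exists_shift hF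
  obtain ⟨d, hd⟩ := h.exists_shift hG
  have hFG (k : ℤ) : (F * G) (ι k) = ι (k + (c + d)) := by
    rw [LineLift.mul_apply, hd, hc, add_assoc, add_comm d]
  rw [h.translationNumber_eq hFG, h.translationNumber_eq hc, h.translationNumber_eq hd]
  push_cast
  ring

end IsPeriodicFinite

/-- The elements that act through `Φ` by maps preserving `X`. -/
def IsPeriodicFinite.stabilizer {W : Type*} [Group W] {X : Set ℝ} (hX : IsPeriodicFinite X)
    (Φ : W →* LineLift) : Subgroup W where
  carrier := {w | MapsTo (Φ w) X X}
  one_mem' x hx := by simpa using hx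
  mul_mem' hv hw x hx := by
    rw [map_mul]
    exact hv (hw hx)
  inv_mem' hw := by
    rw [mem_ofPred_eq, map_inv]
    exact hX.mapsTo_inv hw

/-- A subgroup acts on the circle with a finite orbit, expressed through lifts to the line. -/
def FiniteOrbitOn {W : Type*} [Group W] (Φ : W →* LineLift) (K : Subgroup W) : Prop :=
  ∃ X, ∃ hX : IsPeriodicFinite X, K ≤ hX.stabilizer Φ

theorem hasFiniteOrbit_map_iff {W Γ : Type*} [Group W] [Group Γ] {q : W →* Γ}
    {Φ : W →* LineLift} {σ : CircleRep Γ} (h : ∀ w, LineLift.toHomeoPlus (Φ w) = σ (q w))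
    (K : Subgroup W) : σ.HasFiniteOrbit (K.map q) ↔ FiniteOrbitOn Φ K := by
  have hact (w : W) (x : ℝ) : (σ (q w) : UnitAddCircle ≃ₜ UnitAddCircle) x = (Φ w x : ℝ) := by
    rw [← h, LineLift.toHomeoPlus_apply]
  constructor
  · rintro ⟨z, hz⟩
    set orbit : Set UnitAddCircle :=
      {y | ∃ γ ∈ K.map q, y = (σ γ : UnitAddCircle ≃ₜ UnitAddCircle) z}
    obtain ⟨x, rfl⟩ := QuotientAddGroup.mk_surjective z
    refine ⟨(fun x : ℝ => (x : UnitAddCircle)) ⁻¹' orbit, ⟨⟨x, 1, one_mem _, by simp⟩,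
      fun y n => by simp only [mem_preimage, LineLift.coe_add_int],
      hz.subset (image_preimage_subset _ _)⟩, fun w hw y hy => ?_⟩
    obtain ⟨γ, hγ, hy⟩ := hy
    dsimp only at hy
    refine ⟨q w * γ, mul_mem (Subgroup.mem_map_of_mem q hw) hγ, ?_⟩
    dsimp only
    rw [← hact, hy, map_mul]
    rfl
  · rintro ⟨X, hX, hK⟩
    obtain ⟨x, hx⟩ := hX.nonempty
    refine ⟨x, hX.finite.subset ?_⟩
    rintro _ ⟨_, ⟨w, hw, rfl⟩, rfl⟩
    exact ⟨Φ w x, hK hw hx, (hact w x).symm⟩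

/-! ### Automorphisms of surface groups -/

theorem map_surfaceComm {G H : Type*} [Group G] [Group H] (f : G →* H) (a b : G) :
    f (surfaceComm a b) = surfaceComm (f a) (f b) := by
  simp [surfaceComm]

theorem map_surfaceRelator {g : ℕ} {G : Type*} [Group G] (Ψ : FreeGroup (SurfaceGen g) →* G) :
    Ψ (surfaceRelator g) = ((List.ofFn fun i : Fin g =>
      surfaceComm (Ψ (FreeGroup.of (i, false))) (Ψ (FreeGroup.of (i, true)))).reverse).prod := by
  simp only [surfaceRelator, map_list_prod, List.map_reverse, List.map_ofFn, Function.comp_def,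
    map_surfaceComm]

theorem exists_mulAut_of_lift {α : Type*} {f f' : α → FreeGroup α}
    (hf : ∀ j, FreeGroup.lift f (f' j) = FreeGroup.of j)
    (hf' : ∀ j, FreeGroup.lift f' (f j) = FreeGroup.of j) :
    ∃ θ : MulAut (FreeGroup α), ∀ j, θ (FreeGroup.of j) = f j :=
  ⟨MonoidHom.toMulEquiv (FreeGroup.lift f) (FreeGroup.lift f') (by ext j; simp [hf'])
    (by ext j; simp [hf]), fun _ => FreeGroup.lift_apply_of⟩

section Extend

variable {α β : Type*} (e : α ↪ β)

/-- The endomorphism of the free group on `β` that acts as `θ` on the generators from `α` and fixes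
the other generators. -/
noncomputable def extendHom (θ : FreeGroup α →* FreeGroup α) : FreeGroup β →* FreeGroup β :=
  FreeGroup.lift (Function.extend e (fun a => FreeGroup.map e (θ (FreeGroup.of a))) FreeGroup.of)

theorem extendHom_map (θ : FreeGroup α →* FreeGroup α) (w : FreeGroup α) :
    extendHom e θ (FreeGroup.map e w) = FreeGroup.map e (θ w) := by
  have h : (extendHom e θ).comp (FreeGroup.map e) = (FreeGroup.map e).comp θ := by
    ext a
    simp [extendHom, e.injective.extend_apply]
  exact DFunLike.congr_fun h w

theorem extendHom_of_notMem_range (θ : FreeGroup α →* FreeGroup α) {b : β} (hb : b ∉ range e) :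
    extendHom e θ (FreeGroup.of b) = FreeGroup.of b := by
  rw [extendHom, FreeGroup.lift_apply_of, Function.extend_apply' _ _ _ hb]

theorem extendHom_comp_extendHom {θ θ' : FreeGroup α →* FreeGroup α}
    (h : θ.comp θ' = MonoidHom.id _) :
    (extendHom e θ).comp (extendHom e θ') = MonoidHom.id _ := by
  ext b
  by_cases hb : b ∈ range e
  · obtain ⟨a, rfl⟩ := hb
    have ha : θ (θ' (FreeGroup.of a)) = FreeGroup.of a := DFunLike.congr_fun h _
    simp only [MonoidHom.comp_apply, ← FreeGroup.map.of, extendHom_map, ha, MonoidHom.id_apply]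
  · simp only [MonoidHom.comp_apply, extendHom_of_notMem_range e _ hb, MonoidHom.id_apply]

/-- The extension of an automorphism by the identity on the other generators. -/
noncomputable def extendAut (θ : MulAut (FreeGroup α)) : MulAut (FreeGroup β) :=
  MonoidHom.toMulEquiv (extendHom e θ.toMonoidHom) (extendHom e θ.symm.toMonoidHom)
    (extendHom_comp_extendHom e (by ext; simp)) (extendHom_comp_extendHom e (by ext; simp))

theorem extendAut_of (θ : MulAut (FreeGroup α)) (a : α) :
    extendAut e θ (FreeGroup.of (e a)) = FreeGroup.map e (θ (FreeGroup.of a)) := by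
  have h := extendHom_map e θ.toMonoidHom (FreeGroup.of a)
  rwa [FreeGroup.map.of] at h

end Extend

theorem prod_reverse_ofFn_congr {G : Type*} [Group G] {n i k : ℕ} (h : i + k ≤ n)
    {c c' : Fin n → G} (hc : ∀ j : Fin n, (j : ℕ) < i ∨ i + k ≤ j → c j = c' j)
    (hblock : (List.ofFn fun j : Fin k => c ⟨i + j, by lia⟩).reverse.prod =
      (List.ofFn fun j : Fin k => c' ⟨i + j, by lia⟩).reverse.prod) :
    (List.ofFn c).reverse.prod = (List.ofFn c').reverse.prod := by
  obtain ⟨l, rfl⟩ := Nat.exists_eq_add_of_le h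
  have hlow : (List.ofFn fun j : Fin i => c ⟨j, by lia⟩) =
      List.ofFn fun j : Fin i => c' ⟨j, by lia⟩ :=
    congrArg List.ofFn (funext fun j => hc _ (Or.inl j.2))
  have hhigh : (List.ofFn fun j : Fin l => c (j.natAdd _)) =
      List.ofFn fun j : Fin l => c' (j.natAdd _) :=
    congrArg List.ofFn (funext fun j => hc _ (Or.inr (by simp)))
  simp only [List.ofFn_add, List.reverse_append, List.prod_append, hhigh]
  exact congrArg _ (congrArg₂ _ hblock (congrArg (List.prod ∘ List.reverse) hlow))

/-- The inclusion of the generators of `k` consecutive handles, starting from the handle `i`. -/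
def blockEmbedding {g i k : ℕ} (h : i + k ≤ g) : SurfaceGen k ↪ SurfaceGen g where
  toFun j := (⟨i + j.1, by lia⟩, j.2)
  inj' := by
    rintro ⟨j, β⟩ ⟨j', β'⟩ hj
    simpa [Fin.ext_iff] using hj

theorem blockEmbedding_apply {g i k : ℕ} (h : i + k ≤ g) (j : Fin k) (β : Bool) :
    blockEmbedding h (j, β) = (⟨i + j, by lia⟩, β) := rfl

theorem notMem_range_blockEmbedding {g i k : ℕ} (h : i + k ≤ g) {j : SurfaceGen g}
    (hj : (j.1 : ℕ) < i ∨ i + k ≤ j.1) : j ∉ range (blockEmbedding h) := by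
  rintro ⟨⟨j, β⟩, rfl⟩
  rw [blockEmbedding_apply] at hj
  lia

theorem extendAut_blockEmbedding_surfaceRelator {g i k : ℕ} (h : i + k ≤ g)
    {θ : MulAut (FreeGroup (SurfaceGen k))} (hθ : θ (surfaceRelator k) = surfaceRelator k) :
    extendAut (blockEmbedding h) θ (surfaceRelator g) = surfaceRelator g := by
  have hfixed (j : Fin g) (hj : (j : ℕ) < i ∨ i + k ≤ j) (β : Bool) :
      extendAut (blockEmbedding h) θ (FreeGroup.of (j, β)) = FreeGroup.of (j, β) :=
    extendHom_of_notMem_range _ _ (notMem_range_blockEmbedding h hj)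
  have hblock := congrArg (FreeGroup.map (blockEmbedding h)) hθ
  have himage := map_surfaceRelator ((FreeGroup.map (blockEmbedding h)).comp θ.toMonoidHom)
  rw [MonoidHom.comp_apply, MulEquiv.coe_toMonoidHom, hblock, map_surfaceRelator] at himage
  rw [← MulEquiv.coe_toMonoidHom, map_surfaceRelator, surfaceRelator]
  refine prod_reverse_ofFn_congr h (fun j hj => ?_) ?_
  · simp only [MulEquiv.coe_toMonoidHom, hfixed j hj]
  · simpa only [MonoidHom.comp_apply, MulEquiv.coe_toMonoidHom, ← extendAut_of,
      blockEmbedding_apply, FreeGroup.map.of] using himage.symm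

/-- The subgroup of the free group generated by the first `m` pairs of generators. -/
def handleSubgroup (g m : ℕ) : Subgroup (FreeGroup (SurfaceGen g)) :=
  Subgroup.closure (FreeGroup.of '' {j | (j.1 : ℕ) < m})

theorem of_mem_handleSubgroup {g m : ℕ} {j : SurfaceGen g} (hj : (j.1 : ℕ) < m) :
    FreeGroup.of j ∈ handleSubgroup g m :=
  Subgroup.subset_closure (mem_image_of_mem _ hj)

theorem handleSubgroup_mono {g m m' : ℕ} (h : m ≤ m') : handleSubgroup g m ≤ handleSubgroup g m' :=
  Subgroup.closure_mono (image_mono fun _ hj => lt_of_lt_of_le hj h)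

theorem map_blockEmbedding_mem_handleSubgroup {g i k : ℕ} (h : i + k ≤ g)
    (w : FreeGroup (SurfaceGen k)) :
    FreeGroup.map (blockEmbedding h) w ∈ handleSubgroup g (i + k) := by
  rw [FreeGroup.map_eq_lift]
  refine FreeGroup.range_lift_le ?_ ⟨w, rfl⟩
  rintro _ ⟨⟨j, β⟩, rfl⟩
  exact of_mem_handleSubgroup (by rw [blockEmbedding_apply]; lia)

/-- The projection from the free group to the surface group. -/
abbrev surfaceMk (g : ℕ) : FreeGroup (SurfaceGen g) →* SurfaceGroup g :=
  PresentedGroup.mk {surfaceRelator g}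

theorem map_handleSubgroup (g m : ℕ) : (handleSubgroup g m).map (surfaceMk g) =
    Subgroup.closure ((PresentedGroup.of : _ → SurfaceGroup g) '' {j | (j.1 : ℕ) < m}) := by
  rw [handleSubgroup, MonoidHom.map_closure, image_image]
  rfl

/-- Automorphisms of the free group that fix the surface relator and preserve the subgroup
generated by the first `m` pairs of generators; they induce automorphisms of the surface group
that preserve the subsurface formed by the first `m` handles. -/
structure IsLevelAut {g : ℕ} (m : ℕ) (ψ : MulAut (FreeGroup (SurfaceGen g))) : Prop where
  map_relator : ψ (surfaceRelator g) = surfaceRelator g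
  mem_iff : ∀ w, ψ w ∈ handleSubgroup g m ↔ w ∈ handleSubgroup g m

namespace IsLevelAut

variable {g m : ℕ} {ψ ψ' : MulAut (FreeGroup (SurfaceGen g))}

theorem mul (h : IsLevelAut m ψ) (h' : IsLevelAut m ψ') : IsLevelAut m (ψ * ψ') :=
  ⟨by rw [MulAut.mul_apply, h'.map_relator, h.map_relator],
    fun w => by rw [MulAut.mul_apply, h.mem_iff, h'.mem_iff]⟩

theorem one : IsLevelAut m (1 : MulAut (FreeGroup (SurfaceGen g))) :=
  ⟨rfl, fun _ => Iff.rfl⟩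

theorem extendAut {i k : ℕ} (h : i + k ≤ g) {θ : MulAut (FreeGroup (SurfaceGen k))}
    (hθ : θ (surfaceRelator k) = surfaceRelator k) (hm : i + k ≤ m) :
    IsLevelAut m (extendAut (blockEmbedding h) θ) := by
  have hmem (η : FreeGroup (SurfaceGen k) →* FreeGroup (SurfaceGen k)) :
      handleSubgroup g m ≤ (handleSubgroup g m).comap (extendHom (blockEmbedding h) η) := by
    refine (Subgroup.closure_le _).2 ?_
    rintro _ ⟨j, hj, rfl⟩
    rw [SetLike.mem_coe, Subgroup.mem_comap]
    by_cases hrange : j ∈ range (blockEmbedding h)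
    · obtain ⟨j, rfl⟩ := hrange
      rw [← FreeGroup.map.of, extendHom_map]
      exact handleSubgroup_mono hm (map_blockEmbedding_mem_handleSubgroup h _)
    · rw [extendHom_of_notMem_range _ _ hrange]
      exact of_mem_handleSubgroup hj
  refine ⟨extendAut_blockEmbedding_surfaceRelator h hθ, fun w => ⟨fun hw => ?_, fun hw => ?_⟩⟩
  · have := hmem θ.symm.toMonoidHom hw
    rwa [Subgroup.mem_comap, show extendHom _ θ.symm.toMonoidHom _ = w from
      (_root_.extendAut (blockEmbedding h) θ).symm_apply_apply w] at this
  · exact hmem θ.toMonoidHom hw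

end IsLevelAut

section Twist

variable {G : Type*} [Group G]

theorem surfaceComm_zpow_mul_left (a b : G) (n : ℤ) :
    surfaceComm (b ^ n * a) b = surfaceComm a b := by
  simp only [surfaceComm, mul_inv_rev]
  group

theorem surfaceComm_zpow_mul_right (a b : G) (n : ℤ) :
    surfaceComm a (a ^ n * b) = surfaceComm a b := by
  simp only [surfaceComm, mul_inv_rev]
  group

theorem exists_oneHandle_twist (β : Bool) (n : ℤ) :
    ∃ θ : MulAut (FreeGroup (SurfaceGen 1)), θ (surfaceRelator 1) = surfaceRelator 1 ∧
      θ (FreeGroup.of (0, β)) = FreeGroup.of (0, !β) ^ n * FreeGroup.of (0, β) ∧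
      θ (FreeGroup.of (0, !β)) = FreeGroup.of (0, !β) := by
  let f (n : ℤ) : SurfaceGen 1 → FreeGroup (SurfaceGen 1) :=
    Function.update FreeGroup.of (0, β) (FreeGroup.of (0, !β) ^ n * FreeGroup.of (0, β))
  have hf (n : ℤ) : f n (0, β) = FreeGroup.of (0, !β) ^ n * FreeGroup.of (0, β) :=
    Function.update_self ..
  have hf' (n : ℤ) : f n (0, !β) = FreeGroup.of (0, !β) := Function.update_of_ne (by simp) ..
  have hinv (n : ℤ) (j : SurfaceGen 1) : FreeGroup.lift (f n) (f (-n) j) = FreeGroup.of j := by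
    obtain rfl | rfl : j = (0, β) ∨ j = (0, !β) := by
      obtain ⟨j, γ⟩ := j
      simpa [Subsingleton.elim j 0] using Bool.eq_or_eq_not γ β
    · simp only [hf, hf', map_mul, map_zpow, FreeGroup.lift_apply_of]
      group
    · simp only [hf', FreeGroup.lift_apply_of]
  obtain ⟨θ, hθ⟩ := exists_mulAut_of_lift (hinv n) fun j => by simpa using hinv (-n) j
  refine ⟨θ, ?_, by rw [hθ, hf], by rw [hθ, hf']⟩
  rw [← MulEquiv.coe_toMonoidHom, map_surfaceRelator]
  cases β <;>
    simp_all [surfaceRelator, surfaceComm_zpow_mul_left, surfaceComm_zpow_mul_right]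

end Twist

theorem blockEmbedding_one {g : ℕ} (i : Fin g) (β : Bool) :
    blockEmbedding (g := g) (i := i) (k := 1) (by lia) (0, β) = (i, β) := rfl

theorem exists_twist {g : ℕ} (i : Fin g) (β : Bool) (n : ℤ) :
    ∃ ψ : MulAut (FreeGroup (SurfaceGen g)), (∀ m, (i : ℕ) < m → IsLevelAut m ψ) ∧
      ψ (FreeGroup.of (i, β)) = FreeGroup.of (i, !β) ^ n * FreeGroup.of (i, β) ∧
      ∀ j, j ≠ (i, β) → ψ (FreeGroup.of j) = FreeGroup.of j := by
  obtain ⟨θ, hrel, hβ, hβ'⟩ := exists_oneHandle_twist β n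
  have hi : (i : ℕ) + 1 ≤ g := i.2
  have happly (γ : Bool) : extendAut (blockEmbedding hi) θ (FreeGroup.of (i, γ)) =
      FreeGroup.map (blockEmbedding hi) (θ (FreeGroup.of (0, γ))) :=
    extendAut_of (blockEmbedding hi) θ (0, γ)
  refine ⟨extendAut (blockEmbedding hi) θ, fun m hm => .extendAut hi hrel hm, ?_, ?_⟩
  · rw [happly, hβ]
    simp [blockEmbedding_one]
  · rintro ⟨j, γ⟩ hj
    by_cases hji : j = i
    · subst hji
      obtain rfl : γ = !β := (Bool.eq_or_eq_not γ β).resolve_left (by simpa using hj)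
      rw [happly, hβ', FreeGroup.map.of, blockEmbedding_one]
    · exact extendHom_of_notMem_range _ _ (notMem_range_blockEmbedding hi (by simp; lia))

section AdjacentHandles

theorem exists_adjacent_aut {g : ℕ} {i i' : Fin g} (hi : (i' : ℕ) = i + 1)
    {f f' : SurfaceGen 2 → FreeGroup (SurfaceGen 2)}
    (hf : ∀ j, FreeGroup.lift f (f' j) = FreeGroup.of j)
    (hf' : ∀ j, FreeGroup.lift f' (f j) = FreeGroup.of j)
    (hrel : surfaceComm (f (1, false)) (f (1, true)) * surfaceComm (f (0, false)) (f (0, true)) =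
      surfaceComm (FreeGroup.of (1, false)) (FreeGroup.of (1, true)) *
        surfaceComm (FreeGroup.of (0, false)) (FreeGroup.of (0, true))) :
    ∃ ψ : MulAut (FreeGroup (SurfaceGen g)), (∀ m, (i' : ℕ) < m → IsLevelAut m ψ) ∧
      (∀ β, ψ (FreeGroup.of (i, β)) =
        FreeGroup.lift (fun j => FreeGroup.of (![i, i'] j.1, j.2)) (f (0, β))) ∧
      ∀ j : Fin g, (j : ℕ) < i → ∀ β, ψ (FreeGroup.of (j, β)) = FreeGroup.of (j, β) := by
  obtain ⟨θ, hθ⟩ := exists_mulAut_of_lift hf hf'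
  have hθrel : θ (surfaceRelator 2) = surfaceRelator 2 := by
    rw [← MulEquiv.coe_toMonoidHom, map_surfaceRelator]
    simpa [surfaceRelator, hθ, List.ofFn_succ] using hrel
  have hig : (i : ℕ) + 2 ≤ g := by lia
  have hemb (j : SurfaceGen 2) : blockEmbedding hig j = (![i, i'] j.1, j.2) := by
    revert j
    simp [blockEmbedding_apply, Fin.ext_iff, hi]
  refine ⟨extendAut (blockEmbedding hig) θ, fun m hm => .extendAut hig hθrel (by lia),
    fun β => ?_, fun j hj β => ?_⟩
  · have h := extendAut_of (blockEmbedding hig) θ (0, β)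
    rw [hemb, hθ, FreeGroup.map_eq_lift] at h
    simp only [Function.comp_def, hemb] at h
    exact h
  · exact extendHom_of_notMem_range _ _ (notMem_range_blockEmbedding hig (Or.inl hj))

theorem exists_swapAut {g : ℕ} {i i' : Fin g} (hi : (i' : ℕ) = i + 1) :
    ∃ ψ : MulAut (FreeGroup (SurfaceGen g)), (∀ m, (i' : ℕ) < m → IsLevelAut m ψ) ∧
      ∀ β, ψ (FreeGroup.of (i, β)) = FreeGroup.of (i', β) := by
  let x (j : Fin 2) (β : Bool) : FreeGroup (SurfaceGen 2) := FreeGroup.of (j, β)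
  let c (j : Fin 2) : FreeGroup (SurfaceGen 2) := surfaceComm (x j false) (x j true)
  let f (j : SurfaceGen 2) : FreeGroup (SurfaceGen 2) :=
    ![x 1 j.2, c 1 * x 0 j.2 * (c 1)⁻¹] j.1
  let f' (j : SurfaceGen 2) : FreeGroup (SurfaceGen 2) :=
    ![(c 0)⁻¹ * x 1 j.2 * c 0, x 0 j.2] j.1
  have hinv : (∀ j, FreeGroup.lift f (f' j) = FreeGroup.of j) ∧
      ∀ j, FreeGroup.lift f' (f j) = FreeGroup.of j := by
    simp only [surfaceComm, Prod.forall, Bool.forall_bool, Fin.forall_fin_two, map_mul, map_inv,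
      FreeGroup.lift_apply_of, Matrix.cons_val_zero, Matrix.cons_val_one, f, f', c, x]
    refine ⟨⟨⟨?_, ?_⟩, ?_, ?_⟩, ⟨?_, ?_⟩, ?_, ?_⟩ <;> group
  obtain ⟨ψ, hψ, hψi, -⟩ := exists_adjacent_aut hi hinv.1 hinv.2
    (by simp [f, c, x, surfaceComm]; group)
  exact ⟨ψ, hψ, fun β => by simp [hψi, f, x]⟩

theorem exists_mixAut {g : ℕ} {i i' : Fin g} (hi : (i' : ℕ) = i + 1) :
    ∃ ψ : MulAut (FreeGroup (SurfaceGen g)), (∀ m, (i' : ℕ) < m → IsLevelAut m ψ) ∧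
      ψ (FreeGroup.of (i, false)) = FreeGroup.of (i, true) * FreeGroup.of (i, false) ∧
      ψ (FreeGroup.of (i, true)) = FreeGroup.of (i, true) * FreeGroup.of (i', false) *
        (FreeGroup.of (i, true))⁻¹ * (FreeGroup.of (i, false))⁻¹ ∧
      ∀ j : Fin g, (j : ℕ) < i → ∀ β, ψ (FreeGroup.of (j, β)) = FreeGroup.of (j, β) := by
  let a (j : Fin 2) : FreeGroup (SurfaceGen 2) := FreeGroup.of (j, false)
  let b (j : Fin 2) : FreeGroup (SurfaceGen 2) := FreeGroup.of (j, true)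
  let c : FreeGroup (SurfaceGen 2) := a 1 * (b 0)⁻¹ * (a 0)⁻¹
  let d : FreeGroup (SurfaceGen 2) := c * b 0
  let f (j : SurfaceGen 2) : FreeGroup (SurfaceGen 2) :=
    bif j.2 then ![b 0 * a 1 * (b 0)⁻¹ * (a 0)⁻¹, c⁻¹ * b 1] j.1
    else ![b 0 * a 0, c⁻¹ * a 1 * c] j.1
  let f' (j : SurfaceGen 2) : FreeGroup (SurfaceGen 2) :=
    bif j.2 then ![b 0 * d⁻¹, d * b 1] j.1 else ![d * (b 0)⁻¹ * a 0, d * a 1 * d⁻¹] j.1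
  have hinv : (∀ j, FreeGroup.lift f (f' j) = FreeGroup.of j) ∧
      ∀ j, FreeGroup.lift f' (f j) = FreeGroup.of j := by
    simp only [Prod.forall, Bool.forall_bool, Fin.forall_fin_two, cond_false, cond_true, map_mul,
      map_inv, FreeGroup.lift_apply_of, Matrix.cons_val_zero, Matrix.cons_val_one, f, f', a, b,
      c, d]
    refine ⟨⟨⟨?_, ?_⟩, ?_, ?_⟩, ⟨?_, ?_⟩, ?_, ?_⟩ <;> group
  obtain ⟨ψ, hψ, hψi, hψj⟩ := exists_adjacent_aut hi hinv.1 hinv.2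
    (by simp [f, a, b, c, surfaceComm]; group)
  exact ⟨ψ, hψ, by simp [hψi, f, a, b], by simp [hψi, f, a, b], hψj⟩

end AdjacentHandles

/-! ### Bending rotation-rigid representations -/

namespace CircleRep

/-- The rotation numbers of all elements are constant on the path component of `σ`. -/
def IsRotationRigid {Γ : Type*} [Group Γ] (σ : CircleRep Γ) : Prop :=
  ∀ σ' : CircleRep Γ, Joined σ σ' →
    ∀ γ, HomeoPlus.rotationNumber (σ' γ) = HomeoPlus.rotationNumber (σ γ)

variable {Γ Γ' : Type*} [Group Γ] [Group Γ'] {σ : CircleRep Γ}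

theorem PathRigid.isRotationRigid (h : σ.PathRigid) : σ.IsRotationRigid :=
  fun _ hσ' γ => (ChiEquiv.rotationNumber_eq (h hσ') γ).symm

theorem continuous_comp (θ : Γ' →* Γ) :
    Continuous fun σ : CircleRep Γ => (MonoidHom.comp σ θ : CircleRep Γ') := by
  rw [continuous_induced_rng]
  exact continuous_pi fun γ => (continuous_apply (θ γ)).comp continuous_induced_dom

theorem IsRotationRigid.comp (h : σ.IsRotationRigid) (θ : Γ' ≃* Γ) :
    IsRotationRigid (MonoidHom.comp σ θ.toMonoidHom : CircleRep Γ') := by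
  intro σ' hσ' γ
  have hjoined := hσ'.map (continuous_comp θ.symm.toMonoidHom)
  have hσθ : (MonoidHom.comp (MonoidHom.comp σ θ.toMonoidHom) θ.symm.toMonoidHom : CircleRep Γ) =
      σ := by
    ext γ
    simp
  rw [hσθ] at hjoined
  simpa using h _ hjoined (θ γ)

theorem hasFiniteOrbit_comp_iff (σ : CircleRep Γ) (θ : Γ' →* Γ) (K : Subgroup Γ') :
    HasFiniteOrbit (MonoidHom.comp σ θ : CircleRep Γ') K ↔ σ.HasFiniteOrbit (K.map θ) := by
  simp [HasFiniteOrbit]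

end CircleRep

section Bending

variable {g : ℕ} {Φ : FreeGroup (SurfaceGen g) →* LineLift} {σ : CircleRep (SurfaceGroup g)}

/-- `Φ` consists of lifts of the representation `σ` of the surface group. -/
def IsRepLift (Φ : FreeGroup (SurfaceGen g) →* LineLift) (σ : CircleRep (SurfaceGroup g)) : Prop :=
  ∀ w, LineLift.toHomeoPlus (Φ w) = σ (surfaceMk g w)

theorem exists_isRepLift (σ : CircleRep (SurfaceGroup g)) : ∃ Φ, IsRepLift Φ σ := by
  refine ⟨FreeGroup.lift fun j => HomeoPlus.someLift (σ (PresentedGroup.of j)), fun w => ?_⟩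
  have h : LineLift.toHomeoPlus.comp
      (FreeGroup.lift fun j => HomeoPlus.someLift (σ (PresentedGroup.of j))) =
        MonoidHom.comp σ (surfaceMk g) := by
    ext1 j
    simp only [MonoidHom.comp_apply, FreeGroup.lift_apply_of, HomeoPlus.toHomeoPlus_someLift]
    rfl
  exact DFunLike.congr_fun h w

theorem exists_rep_of_lift (h : LineLift.toHomeoPlus (Φ (surfaceRelator g)) = 1) :
    ∃ σ, IsRepLift Φ σ := by
  have hlift : FreeGroup.lift (fun j => LineLift.toHomeoPlus (Φ (FreeGroup.of j))) =
      LineLift.toHomeoPlus.comp Φ := by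
    ext1 j
    simp
  refine ⟨PresentedGroup.toGroup (f := fun j => LineLift.toHomeoPlus (Φ (FreeGroup.of j))) ?_,
    fun w => (DFunLike.congr_fun hlift w).symm⟩
  rintro r rfl
  rw [hlift]
  exact h

theorem IsRepLift.toHomeoPlus_surfaceRelator (hΦ : IsRepLift Φ σ) :
    LineLift.toHomeoPlus (Φ (surfaceRelator g)) = 1 := by
  rw [hΦ, PresentedGroup.one_of_mem (mem_singleton _), map_one]

theorem pointwiseContinuous_freeGroup_lift {α Y : Type*} [TopologicalSpace Y]
    {G : Y → α → LineLift} (hG : ∀ j, LineLift.PointwiseContinuous fun s => G s j)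
    (w : FreeGroup α) : LineLift.PointwiseContinuous fun s => FreeGroup.lift (G s) w := by
  induction w using FreeGroup.induction_on with
  | C1 => simpa using LineLift.PointwiseContinuous.const 1
  | of j => simpa using hG j
  | inv_of j h => simpa only [map_inv] using h.inv
  | mul v w hv hw => simpa only [map_mul] using hv.mul hw

theorem IsRepLift.unique {σ' : CircleRep (SurfaceGroup g)} (h : IsRepLift Φ σ)
    (h' : IsRepLift Φ σ') : σ = σ' := by
  refine MonoidHom.ext fun γ => ?_
  obtain ⟨w, rfl⟩ := PresentedGroup.mk_surjective _ γ
  exact (h w).symm.trans (h' w)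

theorem CircleRep.IsRotationRigid.translationNumber_eq_of_path (hσ : σ.IsRotationRigid)
    {Ψ : unitInterval → FreeGroup (SurfaceGen g) →* LineLift}
    (hcont : ∀ w, LineLift.PointwiseContinuous fun s => Ψ s w) (hΨ0 : IsRepLift (Ψ 0) σ)
    (hrel : ∀ s, Ψ s (surfaceRelator g) = Ψ 0 (surfaceRelator g)) (w : FreeGroup (SurfaceGen g)) :
    translationNumber (Ψ 1 w) = translationNumber (Ψ 0 w) := by
  choose σs hσs using fun s => exists_rep_of_lift (Φ := Ψ s)
    (by rw [hrel, hΨ0.toHomeoPlus_surfaceRelator])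
  have hσs_cont : Continuous σs := by
    rw [continuous_induced_rng]
    refine continuous_pi fun γ => ?_
    obtain ⟨w, rfl⟩ := PresentedGroup.mk_surjective _ γ
    exact (hcont w).toHomeoPlus.congr fun s => hσs s w
  have hjoined (s : unitInterval) : Joined σ (σs s) := by
    rw [← (hσs 0).unique hΨ0]
    have : PathConnectedSpace unitInterval :=
      isPathConnected_iff_pathConnectedSpace.1
        ((convex_Icc (0 : ℝ) 1).isPathConnected (nonempty_Icc.2 zero_le_one))
    exact (PathConnectedSpace.joined 0 s).map hσs_cont
  have hrot (s : unitInterval) : ((translationNumber (Ψ s w) : ℝ) : UnitAddCircle) =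
      HomeoPlus.rotationNumber (σ (surfaceMk g w)) := by
    rw [← HomeoPlus.rotationNumber_toHomeoPlus, hσs s w]
    exact hσ (σs s) (hjoined s) _
  exact LineLift.eq_of_continuous_of_coe_eq (hcont w).translationNumber
    (fun s t => (hrot s).trans (hrot t).symm) 1 0

section Commutator

variable {G : Type*} [Group G] {a b d : G}

theorem surfaceComm_mul_left_of_commute (h : Commute d b) :
    surfaceComm (d * a) b = surfaceComm a b := by
  have hconj : d⁻¹ * b * d = b := by rw [mul_assoc, ← h.eq, inv_mul_cancel_left]
  calc
    surfaceComm (d * a) b = b⁻¹ * a⁻¹ * (d⁻¹ * b * d) * a := by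
      simp only [surfaceComm, mul_inv_rev]
      group
    _ = surfaceComm a b := by rw [hconj, surfaceComm]

theorem surfaceComm_mul_right_of_commute (h : Commute d a) :
    surfaceComm a (d * b) = surfaceComm a b := by
  have hconj : d⁻¹ * a⁻¹ * d = a⁻¹ := by rw [mul_assoc, ← h.inv_right.eq, inv_mul_cancel_left]
  calc
    surfaceComm a (d * b) = b⁻¹ * (d⁻¹ * a⁻¹ * d) * b * a := by
      simp only [surfaceComm, mul_inv_rev]
      group
    _ = surfaceComm a b := by rw [hconj, surfaceComm]

end Commutator

/-- The bending of `Φ` by `c`: the value at each generator `j` is multiplied by `c j`. -/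
noncomputable def bend (Φ : FreeGroup (SurfaceGen g) →* LineLift) (c : SurfaceGen g → LineLift) :
    FreeGroup (SurfaceGen g) →* LineLift :=
  FreeGroup.lift fun j => c j * Φ (FreeGroup.of j)

theorem bend_of (c : SurfaceGen g → LineLift) (j : SurfaceGen g) :
    bend Φ c (FreeGroup.of j) = c j * Φ (FreeGroup.of j) :=
  FreeGroup.lift_apply_of

theorem bend_one : bend Φ 1 = Φ := by
  ext1 j
  rw [bend_of, Pi.one_apply, one_mul]

theorem bend_surfaceRelator {c : SurfaceGen g → LineLift}
    (hcomm : ∀ j, Commute (c j) (Φ (FreeGroup.of (j.1, !j.2))))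
    (hone : ∀ i, c (i, false) = 1 ∨ c (i, true) = 1) :
    bend Φ c (surfaceRelator g) = Φ (surfaceRelator g) := by
  rw [map_surfaceRelator, map_surfaceRelator]
  congr! 4 with i
  rw [bend_of, bend_of]
  rcases hone i with h | h
  · rw [h, one_mul]
    exact surfaceComm_mul_right_of_commute (hcomm (i, true))
  · rw [h, one_mul]
    exact surfaceComm_mul_left_of_commute (hcomm (i, false))

theorem CircleRep.IsRotationRigid.exists_semiconj_bend (hσ : σ.IsRotationRigid)
    (hΦ : IsRepLift Φ σ) {c : SurfaceGen g → LineLift}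
    (hc : ∀ j, LineLift.JoinedInCentralizer (Φ (FreeGroup.of (j.1, !j.2))) (c j))
    (hone : ∀ i, c (i, false) = 1 ∨ c (i, true) = 1) :
    ∃ ξ : CircleDeg1Lift, ∀ w x, ξ (Φ w x) = bend Φ c w (ξ x) := by
  have hpath (j : SurfaceGen g) : ∃ δ : unitInterval → LineLift,
      LineLift.PointwiseContinuous δ ∧ δ 0 = 1 ∧ δ 1 = c j ∧
        (∀ s, Commute (δ s) (Φ (FreeGroup.of (j.1, !j.2)))) ∧ (c j = 1 → ∀ s, δ s = 1) := by
    by_cases hcj : c j = 1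
    · exact ⟨fun _ => 1, .const 1, rfl, hcj.symm, fun _ => .one_left _, fun _ _ => rfl⟩
    · obtain ⟨δ, hδ, hδ0, hδ1, hcomm⟩ := hc j
      exact ⟨δ, hδ, hδ0, hδ1, hcomm, fun h => absurd h hcj⟩
  choose δ hδ hδ0 hδ1 hcomm htriv using hpath
  let Ψ (s : unitInterval) := bend Φ fun j => δ j s
  have hΨ0 : Ψ 0 = Φ := (congrArg _ (funext hδ0)).trans bend_one
  have hrel (s : unitInterval) : Ψ s (surfaceRelator g) = Φ (surfaceRelator g) :=
    bend_surfaceRelator (fun j => hcomm j s)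
      fun i => (hone i).imp (fun h => htriv _ h s) fun h => htriv _ h s
  have htrans (w : FreeGroup (SurfaceGen g)) :
      translationNumber (Φ w) = translationNumber (bend Φ c w) := by
    have h := hσ.translationNumber_eq_of_path (Ψ := Ψ)
      (pointwiseContinuous_freeGroup_lift fun j => (hδ j).mul (.const _))
      (by rwa [hΨ0]) (by simpa only [hΨ0] using hrel) w
    simpa only [hΨ0, Ψ, hδ1] using h.symm
  exact semiconj_of_group_action_of_forall_translationNumber_eq
    ((Units.coeHom CircleDeg1Lift).comp Φ) ((Units.coeHom CircleDeg1Lift).comp (bend Φ c)) htrans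

end Bending

/-! ### Lifts of rotation-rigid representations with very good tori -/

section VeryGood

variable {g h m : ℕ} {Φ : FreeGroup (SurfaceGen g) →* LineLift}
  {ψ : MulAut (FreeGroup (SurfaceGen g))}

/-- `Φ` consists of lifts of a rotation-rigid representation for which all one-holed tori in the
subsurface formed by the first `h` handles have finite orbits. -/
def IsVeryGoodLift (h : ℕ) (Φ : FreeGroup (SurfaceGen g) →* LineLift) : Prop :=
  ∃ σ : CircleRep (SurfaceGroup g), IsRepLift Φ σ ∧ σ.IsRotationRigid ∧
    ∀ K, IsOneHoledSubsurfaceGroup 1 K → K ≤ (handleSubgroup g h).map (surfaceMk g) →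
      σ.HasFiniteOrbit K

theorem IsOneHoledSubsurfaceGroup.map {K : Subgroup (SurfaceGroup g)}
    (hK : IsOneHoledSubsurfaceGroup m K) (θ : SurfaceGroup g ≃* SurfaceGroup g) :
    IsOneHoledSubsurfaceGroup m (K.map θ.toMonoidHom) := by
  obtain ⟨s, ⟨φ, hφ⟩, rfl⟩ := hK
  refine ⟨fun j => θ (s j), ⟨φ.trans θ, fun j => by simp [hφ]⟩, ?_⟩
  rw [MonoidHom.map_closure, image_image]
  rfl

theorem isOneHoledSubsurfaceGroup_map_handleSubgroup (g m : ℕ) :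
    IsOneHoledSubsurfaceGroup m ((handleSubgroup g m).map (surfaceMk g)) :=
  ⟨fun j => PresentedGroup.of j, ⟨MulEquiv.refl _, fun _ => rfl⟩, map_handleSubgroup g m⟩

theorem exists_surfaceGroup_aut (hψ : ψ (surfaceRelator g) = surfaceRelator g) :
    ∃ θ : SurfaceGroup g ≃* SurfaceGroup g, ∀ w, θ (surfaceMk g w) = surfaceMk g (ψ w) := by
  refine ⟨QuotientGroup.congr _ _ ψ ?_, fun w => rfl⟩
  refine (Subgroup.map_normalClosure {surfaceRelator g} ψ.toMonoidHom ψ.surjective).trans ?_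
  simp [hψ]

namespace IsVeryGoodLift

theorem comp (hΦ : IsVeryGoodLift h Φ) (hψ : IsLevelAut h ψ) :
    IsVeryGoodLift h (Φ.comp ψ.toMonoidHom) := by
  obtain ⟨σ, hΦσ, hσ, htori⟩ := hΦ
  obtain ⟨θ, hθ⟩ := exists_surfaceGroup_aut hψ.map_relator
  refine ⟨MonoidHom.comp σ θ.toMonoidHom, fun w => ?_, hσ.comp θ, fun K hK hle => ?_⟩
  · exact (hΦσ (ψ w)).trans (congrArg σ (hθ w).symm)
  · rw [CircleRep.hasFiniteOrbit_comp_iff]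
    refine htori _ (hK.map θ) ?_
    rintro _ ⟨γ, hγ, rfl⟩
    obtain ⟨w, hw, rfl⟩ := hle hγ
    exact ⟨ψ w, (hψ.mem_iff w).2 hw, (hθ w).symm⟩

theorem finiteOrbitOn_one (hΦ : IsVeryGoodLift h Φ) (hh : 1 ≤ h) :
    FiniteOrbitOn Φ (handleSubgroup g 1) := by
  obtain ⟨σ, hΦσ, -, htori⟩ := hΦ
  rw [← hasFiniteOrbit_map_iff hΦσ]
  exact htori _ (isOneHoledSubsurfaceGroup_map_handleSubgroup g 1)
    (Subgroup.map_mono (handleSubgroup_mono hh))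

end IsVeryGoodLift

theorem finiteOrbitOn_comp_levelAut_iff (hψ : IsLevelAut m ψ) :
    FiniteOrbitOn (Φ.comp ψ.toMonoidHom) (handleSubgroup g m) ↔
      FiniteOrbitOn Φ (handleSubgroup g m) := by
  constructor
  · rintro ⟨X, hX, hle⟩
    refine ⟨X, hX, fun w hw => ?_⟩
    obtain ⟨v, rfl⟩ := ψ.surjective w
    exact hle ((hψ.mem_iff v).1 hw)
  · rintro ⟨X, hX, hle⟩
    exact ⟨X, hX, fun w hw => show ψ w ∈ hX.stabilizer Φ from hle ((hψ.mem_iff w).2 hw)⟩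

end VeryGood

/-! ### Squeezing a finite orbit by a pair of bendings -/

namespace LineLift

theorem JoinedInCentralizer.one (Z : LineLift) : JoinedInCentralizer Z 1 :=
  ⟨fun _ => 1, .const 1, rfl, rfl, fun _ => .one_left Z⟩

theorem JoinedInCentralizer.commute {Z C : LineLift} (h : JoinedInCentralizer Z C) :
    Commute C Z := by
  obtain ⟨δ, -, -, rfl, hcomm⟩ := h
  exact hcomm 1

theorem semiconj_pow {ζ : CircleDeg1Lift} {F G : LineLift} (h : ∀ x, ζ (F x) = G (ζ x)) (n : ℕ)
    (x : ℝ) : ζ ((F ^ n) x) = (G ^ n) (ζ x) := by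
  simpa only [Units.val_pow_eq_pow_val, coe_pow] using
    (Function.Semiconj.iterate_right (f := ζ) (ga := F) (gb := G) h n) x

theorem exists_joinedInCentralizer_squeeze_periodic {Z F : LineLift} {q : ℝ} (hq : Z q = q)
    (U : LineLift) {n : ℕ} {m : ℤ} (hF : interior {y : ℝ | (F ^ n) y = y + m} = ∅) {ε : ℝ}
    (hε : 0 < ε) :
    ∃ D, JoinedInCentralizer Z D ∧ ∀ y : ℝ, (F ^ n) y = y + m →
      (F ^ n) (D (U y)) = D (U y) + m → |D (U y) - U y| < ε ∧ |Z (U y) - U y| < ε := by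
  have hclosed : IsClosed {y : ℝ | (F ^ n) y = y + m} :=
    isClosed_eq (F ^ n).continuous (continuous_id.add continuous_const)
  have hper : IsIntPeriodic {y : ℝ | (F ^ n) y = y + m} := fun x k => by
    simp only [mem_ofPred_eq, map_add_int, add_right_comm x, add_left_inj]
  have hint : interior ((U⁻¹ : LineLift) ⁻¹' {y : ℝ | (F ^ n) y = y + m}) = ∅ := by
    rw [← coe_toOrderIso, ← OrderIso.coe_toHomeomorph, ← Homeomorph.preimage_interior, hF,
      preimage_empty]
  obtain ⟨D, hD, hsq⟩ := exists_joinedInCentralizer_squeeze hq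
    (hclosed.preimage U⁻¹.continuous) (fun x k => by
      rw [mem_preimage, map_add_int, hper, mem_preimage]) hint hclosed hper hF hε
  refine ⟨D, hD, fun y hy hDy => hsq (U y) ?_ hDy⟩
  rwa [mem_preimage, units_inv_apply_apply]

end LineLift

theorem exists_ultrafilter_tendsto_circleDeg1Lift {ζ : ℕ → CircleDeg1Lift}
    (h : ∀ k, ζ k 0 ∈ Icc (0 : ℝ) 1) :
    ∃ (𝒰 : Ultrafilter ℕ) (η : CircleDeg1Lift), (𝒰 : Filter ℕ) ≤ atTop ∧
      ∀ x, Tendsto (fun k => ζ k x) 𝒰 (𝓝 (η x)) := by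
  have hlim (x : ℝ) : ∃ a, Tendsto (fun k => ζ k x) (hyperfilter ℕ : Ultrafilter ℕ) (𝓝 a) := by
    have hmem (k : ℕ) : ζ k x ∈ Icc (⌊x⌋ : ℝ) (1 + ⌈x⌉) :=
      ⟨by linarith [(ζ k).le_map_of_map_zero x, (h k).1],
        by linarith [(ζ k).map_le_of_map_zero x, (h k).2]⟩
    obtain ⟨a, -, ha⟩ := isCompact_Icc.ultrafilter_le_nhds
      ((hyperfilter ℕ : Ultrafilter ℕ).map fun k => ζ k x)
      (tendsto_principal.2 (Eventually.of_forall hmem))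
    exact ⟨a, ha⟩
  choose η hη using hlim
  refine ⟨hyperfilter ℕ, ⟨⟨η, fun x y hxy => ?_⟩, fun x => ?_⟩,
    Nat.hyperfilter_le_atTop, hη⟩
  · exact le_of_tendsto_of_tendsto' (hη x) (hη y) fun k => (ζ k).monotone hxy
  · exact tendsto_nhds_unique (hη (x + 1))
      (((hη x).add_const 1).congr fun k => ((ζ k).map_add_one x).symm)

theorem eq_of_tendsto_of_abs_sub_lt {l : Filter ℕ} [l.NeBot] (hl : l ≤ atTop) {u v : ℕ → ℝ}
    {a b : ℝ} (hu : Tendsto u l (𝓝 a)) (hv : Tendsto v l (𝓝 b))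
    (h : ∀ k : ℕ, |u k - v k| < 1 / (k + 1)) : a = b := by
  have hsub : Tendsto (fun k => u k - v k) l (𝓝 0) :=
    squeeze_zero_norm (fun k => (h k).le) (tendsto_one_div_add_atTop_nhds_zero_nat.mono_left hl)
  exact sub_eq_zero.1 (tendsto_nhds_unique (hu.sub hv) hsub)

section Squeeze

variable {g : ℕ} {Φ : FreeGroup (SurfaceGen g) →* LineLift} {σ : CircleRep (SurfaceGroup g)}
  {p r : SurfaceGen g} {T U : FreeGroup (SurfaceGen g)}

/-- The bending of `Φ` by `C` at the generator `p` and by `D` at the generator `r`. -/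
noncomputable def bendPair (Φ : FreeGroup (SurfaceGen g) →* LineLift) (p r : SurfaceGen g)
    (C D : LineLift) : FreeGroup (SurfaceGen g) →* LineLift :=
  bend Φ (Function.update (Function.update 1 p C) r D)

theorem bendPair_of_left (hpr : p ≠ r) (C D : LineLift) :
    bendPair Φ p r C D (FreeGroup.of p) = C * Φ (FreeGroup.of p) := by
  rw [bendPair, bend_of, Function.update_of_ne hpr, Function.update_self]

theorem bendPair_of_right (C D : LineLift) :
    bendPair Φ p r C D (FreeGroup.of r) = D * Φ (FreeGroup.of r) := by
  rw [bendPair, bend_of, Function.update_self]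

theorem bendPair_of_ne {j : SurfaceGen g} (hp : j ≠ p) (hr : j ≠ r) (C D : LineLift) :
    bendPair Φ p r C D (FreeGroup.of j) = Φ (FreeGroup.of j) := by
  rw [bendPair, bend_of, Function.update_of_ne hr, Function.update_of_ne hp, Pi.one_apply, one_mul]

/-- The words `T` and `U` are multiplied on the left by `C` and `D`, respectively, whenever `Φ` is
bent at `p` by `C` and at `r` by `D`, where `C` and `D` commute with the values of `Φ` at the
generators dual to `p` and `r`. -/
def IsBendPair (Φ : FreeGroup (SurfaceGen g) →* LineLift) (p r : SurfaceGen g)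
    (T U : FreeGroup (SurfaceGen g)) : Prop :=
  ∀ C D, Commute C (Φ (FreeGroup.of (p.1, !p.2))) → Commute D (Φ (FreeGroup.of (r.1, !r.2))) →
    bendPair Φ p r C D T = C * Φ T ∧ bendPair Φ p r C D U = D * Φ U

theorem CircleRep.IsRotationRigid.exists_semiconj_bendPair (hσ : σ.IsRotationRigid)
    (hΦ : IsRepLift Φ σ) (hpr : p.1 ≠ r.1) {C D : LineLift}
    (hC : LineLift.JoinedInCentralizer (Φ (FreeGroup.of (p.1, !p.2))) C)
    (hD : LineLift.JoinedInCentralizer (Φ (FreeGroup.of (r.1, !r.2))) D) :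
    ∃ ζ : CircleDeg1Lift, ζ 0 ∈ Icc (0 : ℝ) 1 ∧
      ∀ w x, ζ (Φ w x) = bendPair Φ p r C D w (ζ x) := by
  let c : SurfaceGen g → LineLift := Function.update (Function.update 1 p C) r D
  let IsAdmissible (j : SurfaceGen g) (F : LineLift) : Prop :=
    LineLift.JoinedInCentralizer (Φ (FreeGroup.of (j.1, !j.2))) F
  have hc : ∀ j, IsAdmissible j (c j) :=
    (Function.forall_update_iff _ IsAdmissible).2 ⟨hD, fun j _ =>
      (Function.forall_update_iff _ IsAdmissible).2 ⟨hC, fun j _ => .one _⟩ j⟩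
  have hone (i : Fin g) : c (i, false) = 1 ∨ c (i, true) = 1 := by
    obtain ⟨i₁, β₁⟩ := p
    obtain ⟨i₂, β₂⟩ := r
    rcases eq_or_ne i i₁ with rfl | h₁
    · cases β₁ <;> simp [c, Prod.ext_iff, (show i ≠ i₂ from hpr)]
    · cases β₂ <;> simp [c, Function.update_apply, Prod.ext_iff, h₁]
  obtain ⟨ξ, hξ⟩ := hσ.exists_semiconj_bend hΦ hc hone
  have hζ (x : ℝ) : (translate (Multiplicative.ofAdd ((-⌊ξ 0⌋ : ℤ) : ℝ)) * ξ : CircleDeg1Lift) x =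
      ((-⌊ξ 0⌋ : ℤ) : ℝ) + ξ x := translate_apply _ _
  refine ⟨_, ?_, fun w x => by rw [hζ, hζ, map_int_add, hξ, bendPair]⟩
  rw [hζ, Int.cast_neg, neg_add_eq_sub, Int.self_sub_floor]
  exact ⟨Int.fract_nonneg _, (Int.fract_lt_one _).le⟩

-- `C` gives `T` a periodic set without interior, which contains the image of `X`; then `D` can move
-- the `U`-image of this set almost off it.
theorem CircleRep.IsRotationRigid.exists_approx_semiconj (hσ : σ.IsRotationRigid)
    (hΦ : IsRepLift Φ σ) (hpr : p.1 ≠ r.1) (hTU : IsBendPair Φ p r T U) {q q' : ℝ}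
    (hq : Φ (FreeGroup.of (p.1, !p.2)) q = q) (hq' : Φ (FreeGroup.of (r.1, !r.2)) q' = q')
    {X : Set ℝ} (hX : IsPeriodicFinite X) (hXT : MapsTo (Φ T) X X) (hXU : MapsTo (Φ U) X X)
    {ε : ℝ} (hε : 0 < ε) :
    ∃ ζ : CircleDeg1Lift, ζ 0 ∈ Icc (0 : ℝ) 1 ∧
      (∀ j, j ≠ p → j ≠ r → ∀ x, ζ (Φ (FreeGroup.of j) x) = Φ (FreeGroup.of j) (ζ x)) ∧
      (∀ x, |ζ (Φ T x) - Φ T (ζ x)| < ε) ∧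
      ∀ x ∈ X, |ζ (Φ U x) - Φ U (ζ x)| < ε ∧
        |Φ (FreeGroup.of (r.1, !r.2)) (Φ U (ζ x)) - Φ U (ζ x)| < ε := by
  obtain ⟨n, hn, hper⟩ := hX.exists_period
  obtain ⟨m, -, hm⟩ := hper _ hXT
  obtain ⟨C, hC, hCε, hCint⟩ :=
    LineLift.exists_joinedInCentralizer_interior_periodic_eq_empty hq (Φ T) hn m hε
  obtain ⟨D, hD, hsq⟩ := LineLift.exists_joinedInCentralizer_squeeze_periodic hq' (Φ U) hCint hε
  obtain ⟨ζ, hζ0, hζ⟩ := hσ.exists_semiconj_bendPair hΦ hpr hC hD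
  obtain ⟨hT, hU⟩ := hTU C D hC.commute hD.commute
  have hζT (x : ℝ) : ζ (Φ T x) = (C * Φ T) (ζ x) := by rw [hζ, hT]
  have hζU (x : ℝ) : ζ (Φ U x) = D (Φ U (ζ x)) := by rw [hζ, hU, LineLift.mul_apply]
  have hζX {x : ℝ} (hx : x ∈ X) : ((C * Φ T) ^ n) (ζ x) = ζ x + m := by
    rw [← LineLift.semiconj_pow hζT, hm x hx, map_add_int]
  refine ⟨ζ, hζ0, fun j hp hr x => by rw [hζ, bendPair_of_ne hp hr], fun x => ?_, fun x hx => ?_⟩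
  · rw [hζT]
    exact hCε _
  · rw [hζU]
    exact hsq (ζ x) (hζX hx) (hζU x ▸ hζX (hXU hx))

theorem CircleRep.IsRotationRigid.exists_semiconj_fixed (hσ : σ.IsRotationRigid)
    (hΦ : IsRepLift Φ σ) (hpr : p.1 ≠ r.1) (hTU : IsBendPair Φ p r T U) {q q' : ℝ}
    (hq : Φ (FreeGroup.of (p.1, !p.2)) q = q) (hq' : Φ (FreeGroup.of (r.1, !r.2)) q' = q')
    {X : Set ℝ} (hX : IsPeriodicFinite X) (hXT : MapsTo (Φ T) X X) (hXU : MapsTo (Φ U) X X) :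
    ∃ ζ : CircleDeg1Lift,
      (∀ j, j ≠ p → j ≠ r → ∀ x, ζ (Φ (FreeGroup.of j) x) = Φ (FreeGroup.of j) (ζ x)) ∧
      (∀ x, ζ (Φ T x) = Φ T (ζ x)) ∧ (∀ x ∈ X, ζ (Φ U x) = Φ U (ζ x)) ∧
      ∀ x ∈ X, Φ (FreeGroup.of (r.1, !r.2)) (ζ x) = ζ x := by
  choose η hη0 hηj hηT hηU using fun k : ℕ =>
    hσ.exists_approx_semiconj hΦ hpr hTU hq hq' hX hXT hXU (ε := 1 / (k + 1)) (by positivity)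
  obtain ⟨𝒰, ζ, h𝒰, hζ⟩ := exists_ultrafilter_tendsto_circleDeg1Lift hη0
  have hcont (F : LineLift) {u : ℕ → ℝ} {a : ℝ} (h : Tendsto u 𝒰 (𝓝 a)) :
      Tendsto (fun k => F (u k)) 𝒰 (𝓝 (F a)) := (F.continuous.tendsto a).comp h
  have hζU (x : ℝ) (hx : x ∈ X) : ζ (Φ U x) = Φ U (ζ x) :=
    eq_of_tendsto_of_abs_sub_lt h𝒰 (hζ _) (hcont _ (hζ x)) fun k => (hηU k x hx).1
  refine ⟨ζ, fun j hp hr x => ?_, fun x => ?_, hζU, fun x hx => ?_⟩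
  · exact tendsto_nhds_unique (hζ _) ((hcont _ (hζ x)).congr fun k => (hηj k j hp hr x).symm)
  · exact eq_of_tendsto_of_abs_sub_lt h𝒰 (hζ _) (hcont _ (hζ x)) fun k => hηT k x
  · have hy : (Φ U)⁻¹ x ∈ X := hX.mapsTo_inv hXU hx
    have hfix := eq_of_tendsto_of_abs_sub_lt h𝒰 (hcont _ (hcont _ (hζ _))) (hcont _ (hζ _))
      fun k => (hηU k _ hy).2
    rwa [← hζU _ hy, units_apply_inv_apply] at hfix

end Squeeze

section Phases

variable {g : ℕ} {Φ : FreeGroup (SurfaceGen g) →* LineLift} {σ : CircleRep (SurfaceGroup g)}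
  {i i' : Fin g}

theorem IsPeriodicFinite.mem_stabilizer_image {W : Type*} [Group W] {Φ : W →* LineLift} {X : Set ℝ}
    {hX : IsPeriodicFinite X} {ζ : CircleDeg1Lift} {w : W} (hw : w ∈ hX.stabilizer Φ)
    (h : ∀ x ∈ X, ζ (Φ w x) = Φ w (ζ x)) : w ∈ (hX.image ζ.map_add_int).stabilizer Φ := by
  rintro _ ⟨x, hx, rfl⟩
  exact ⟨Φ w x, hw hx, h x hx⟩

theorem IsPeriodicFinite.conj_mem_stabilizer_image {W : Type*} [Group W] {Φ : W →* LineLift}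
    {X : Set ℝ} {hX : IsPeriodicFinite X} {w : W} (hw : w ∈ hX.stabilizer Φ) (v : W) :
    v * w * v⁻¹ ∈ (hX.image (Φ v : CircleDeg1Lift).map_add_int).stabilizer Φ := by
  rintro _ ⟨x, hx, rfl⟩
  refine ⟨Φ w x, hw hx, ?_⟩
  rw [map_mul, map_mul, map_inv, LineLift.mul_apply, units_inv_apply_apply, LineLift.mul_apply]

theorem isBendPair_of {p r : SurfaceGen g} (hpr : p ≠ r) :
    IsBendPair Φ p r (FreeGroup.of p) (FreeGroup.of r) :=
  fun C D _ _ => ⟨bendPair_of_left hpr C D, bendPair_of_right C D⟩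

theorem CircleRep.IsRotationRigid.exists_stabilizer_pair (hσ : σ.IsRotationRigid)
    (hΦ : IsRepLift Φ σ) (hii : i ≠ i') {q q' : ℝ} (hq : Φ (FreeGroup.of (i, false)) q = q)
    (hq' : Φ (FreeGroup.of (i', true)) q' = q') {X : Set ℝ} (hX : IsPeriodicFinite X)
    (hb : FreeGroup.of (i, true) ∈ hX.stabilizer Φ)
    (ha' : FreeGroup.of (i', false) ∈ hX.stabilizer Φ) :
    ∃ E, ∃ hE : IsPeriodicFinite E, FreeGroup.of (i', true) ∈ hE.stabilizer Φ ∧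
      ∀ j, FreeGroup.of j ∈ hX.stabilizer Φ → FreeGroup.of j ∈ hE.stabilizer Φ := by
  obtain ⟨ζ, hζ, hζb, hζa', hfix⟩ := hσ.exists_semiconj_fixed hΦ (p := (i, true))
    (r := (i', false)) hii (isBendPair_of fun h => hii (congrArg Prod.fst h)) hq hq' hX hb ha'
  refine ⟨_, hX.image ζ.map_add_int, ?_, fun j hj => IsPeriodicFinite.mem_stabilizer_image hj ?_⟩
  · rintro _ ⟨x, hx, rfl⟩
    exact ⟨x, hx, (hfix x hx).symm⟩
  · rcases eq_or_ne j (i, true) with rfl | hj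
    · exact fun x _ => hζb x
    rcases eq_or_ne j (i', false) with rfl | hj'
    · exact hζa'
    · exact fun x _ => hζ j hj hj' x

theorem isBendPair_mix (hii : i ≠ i') :
    IsBendPair Φ (i', false) (i, true)
      (FreeGroup.of (i', false) * (FreeGroup.of (i, true))⁻¹ * (FreeGroup.of (i, false))⁻¹ *
        FreeGroup.of (i, true))
      (FreeGroup.of (i, false) * FreeGroup.of (i, true)) := by
  intro C D _ hD
  have hne : (i', false) ≠ (i, true) := by simp
  have ha : bendPair Φ (i', false) (i, true) C D (FreeGroup.of (i, false)) =
      Φ (FreeGroup.of (i, false)) := bendPair_of_ne (by simp [hii]) (by simp) C D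
  simp only [map_mul, map_inv, ha, bendPair_of_left hne, bendPair_of_right]
  have hD : Commute D (Φ (FreeGroup.of (i, false))) := hD
  generalize Φ (FreeGroup.of (i, false)) = a at *
  generalize Φ (FreeGroup.of (i, true)) = b
  generalize Φ (FreeGroup.of (i', false)) = a'
  constructor
  · calc C * a' * (D * b)⁻¹ * a⁻¹ * (D * b) = C * a' * b⁻¹ * (D⁻¹ * a⁻¹ * D) * b := by group
      _ = C * (a' * b⁻¹ * a⁻¹ * b) := by
        rw [mul_assoc D⁻¹, ← hD.inv_right.eq, inv_mul_cancel_left]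
        group
  · rw [← mul_assoc, ← hD.eq, mul_assoc]

theorem CircleRep.IsRotationRigid.exists_semiconj_mix (hσ : σ.IsRotationRigid)
    (hΦ : IsRepLift Φ σ) (hii : i ≠ i') {q q' : ℝ} (hq : Φ (FreeGroup.of (i, false)) q = q)
    (hq' : Φ (FreeGroup.of (i', true)) q' = q') {X : Set ℝ} (hX : IsPeriodicFinite X)
    (hba : FreeGroup.of (i, true) * FreeGroup.of (i, false) ∈ hX.stabilizer Φ)
    (hmix : FreeGroup.of (i, true) * FreeGroup.of (i', false) * (FreeGroup.of (i, true))⁻¹ *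
      (FreeGroup.of (i, false))⁻¹ ∈ hX.stabilizer Φ) :
    ∃ ζ : CircleDeg1Lift,
      (∀ j : SurfaceGen g, j.1 ≠ i → j.1 ≠ i' →
        ∀ x, ζ (Φ (FreeGroup.of j) x) = Φ (FreeGroup.of j) (ζ x)) ∧
      ∀ x ∈ X, Φ (FreeGroup.of (i, false)) (ζ x) = ζ x ∧
        Φ (FreeGroup.of (i, true)) (ζ x) ∈ ζ '' X ∧
          Φ (FreeGroup.of (i', false)) (ζ x) ∈ ζ '' X := by
  set a := FreeGroup.of (i, false)
  set b := FreeGroup.of (i, true)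
  set a' := FreeGroup.of (i', false)
  -- Conjugation by `b⁻¹` turns the two words into a bend pair; since `b * a` preserves `X`, the
  -- elements `b⁻¹` and `a` map `X` to the same set.
  have hX' := hX.image (Φ a : CircleDeg1Lift).map_add_int
  have hT : a' * b⁻¹ * a⁻¹ * b ∈ hX'.stabilizer Φ := by
    have h := IsPeriodicFinite.conj_mem_stabilizer_image
      (mul_mem (mul_mem (inv_mem hba) hmix) hba) a
    convert h using 1
    group
  have hU : a * b ∈ hX'.stabilizer Φ := by
    simpa only [mul_assoc, mul_inv_cancel, mul_one] using
      IsPeriodicFinite.conj_mem_stabilizer_image hba a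
  obtain ⟨ζ, hζ, hζT, hζU, hfix⟩ :=
    hσ.exists_semiconj_fixed hΦ hii.symm (isBendPair_mix hii) hq' hq hX' hT hU
  have hζa (x : ℝ) : ζ (Φ a x) = Φ a (ζ x) := hζ _ (by simp [hii]) (by simp) x
  have hζX {x : ℝ} (hx : x ∈ X) : ζ (Φ a x) = ζ x :=
    (Φ a).strictMono.injective ((hfix _ (mem_image_of_mem _ hx)).trans (hζa x))
  have hafix {x : ℝ} (hx : x ∈ X) : Φ a (ζ x) = ζ x := by rw [← hζa, hζX hx]
  have hζb {x : ℝ} (hx : x ∈ X) : Φ b (ζ x) = ζ (Φ (b * a) x) := by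
    have h := hζU _ (mem_image_of_mem _ hx)
    rw [map_mul, LineLift.mul_apply, LineLift.mul_apply, hζa, hζX hx] at h
    rw [map_mul, LineLift.mul_apply]
    exact ((Φ a).strictMono.injective h).symm
  refine ⟨ζ, fun j hi hi' => hζ j (fun h => hi' (h ▸ rfl)) fun h => hi (h ▸ rfl), fun x hx =>
    ⟨hafix hx, ⟨_, hba hx, (hζb hx).symm⟩, ?_⟩⟩
  obtain ⟨y, hy, hTy⟩ := hT (mem_image_of_mem _ hx)
  have hcancel : (Φ b)⁻¹ ((Φ a)⁻¹ (Φ b (ζ x))) = ζ x := by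
    rw [hζb hx, (Φ a).inv_apply_eq_iff.2 (hafix (hba hx)).symm, ← hζb hx, units_inv_apply_apply]
  refine ⟨y, hy, ?_⟩
  rw [← hζX hy, hTy, hζT, hζX hx]
  simp only [map_mul, map_inv, LineLift.mul_apply]
  exact congrArg (Φ a') hcancel

theorem CircleRep.IsRotationRigid.exists_stabilizer_mix (hσ : σ.IsRotationRigid)
    (hΦ : IsRepLift Φ σ) (hii : i ≠ i') {q q' : ℝ} (hq : Φ (FreeGroup.of (i, false)) q = q)
    (hq' : Φ (FreeGroup.of (i', true)) q' = q') {X : Set ℝ} (hX : IsPeriodicFinite X)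
    (hba : FreeGroup.of (i, true) * FreeGroup.of (i, false) ∈ hX.stabilizer Φ)
    (hmix : FreeGroup.of (i, true) * FreeGroup.of (i', false) * (FreeGroup.of (i, true))⁻¹ *
      (FreeGroup.of (i, false))⁻¹ ∈ hX.stabilizer Φ) :
    ∃ E, ∃ hE : IsPeriodicFinite E, (∀ β, FreeGroup.of (i, β) ∈ hE.stabilizer Φ) ∧
      FreeGroup.of (i', false) ∈ hE.stabilizer Φ ∧
      ∀ j : SurfaceGen g, j.1 ≠ i → j.1 ≠ i' → FreeGroup.of j ∈ hX.stabilizer Φ →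
        FreeGroup.of j ∈ hE.stabilizer Φ := by
  obtain ⟨ζ, hζ, hζX⟩ := hσ.exists_semiconj_mix hΦ hii hq hq' hX hba hmix
  refine ⟨_, hX.image ζ.map_add_int, ?_, ?_, fun j hi hi' hj =>
    IsPeriodicFinite.mem_stabilizer_image hj fun x _ => hζ j hi hi' x⟩
  · rintro (_ | _) _ ⟨x, hx, rfl⟩
    · exact ⟨x, hx, (hζX x hx).1.symm⟩
    · exact (hζX x hx).2.1
  · rintro _ ⟨x, hx, rfl⟩
    exact (hζX x hx).2.2

end Phases

section Normalization

theorem exists_natAbs_add_mul_add_mul_lt {x : ℤ} (hx : x ≠ 0) (y : ℤ) :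
    ∃ q p : ℤ, (x + p * (y + q * x)).natAbs < x.natAbs := by
  rcases eq_or_ne (y % x) 0 with hr | hr
  · refine ⟨1 - y / x, -1, ?_⟩
    have hzero : x + -1 * (y + (1 - y / x) * x) = 0 := by
      linear_combination Int.emod_add_mul_ediv y x - hr
    rw [hzero]
    exact Int.natAbs_pos.2 hx
  · refine ⟨-(y / x), -(x / (y % x)), ?_⟩
    have hrem : y + -(y / x) * x = y % x := by
      linear_combination -Int.emod_add_mul_ediv y x
    have hrem' : x + -(x / (y % x)) * (y % x) = x % (y % x) := by
      linear_combination -Int.emod_add_mul_ediv x (y % x)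
    rw [hrem, hrem']
    have hy := Int.emod_nonneg y hx
    have hx' := Int.emod_nonneg x hr
    have hlt := Int.emod_lt_abs y hx
    have hlt' := Int.emod_lt_abs x hr
    rw [abs_of_nonneg hy] at hlt'
    rw [Int.abs_eq_natAbs] at hlt
    omega

theorem exists_twist_twist {g : ℕ} (i : Fin g) (β : Bool) (q p : ℤ) :
    ∃ ψ : MulAut (FreeGroup (SurfaceGen g)), (∀ m, (i : ℕ) < m → IsLevelAut m ψ) ∧
      (∀ j : Fin g, j ≠ i → ∀ γ, ψ (FreeGroup.of (j, γ)) = FreeGroup.of (j, γ)) ∧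
      ψ (FreeGroup.of (i, !β)) = FreeGroup.of (i, β) ^ q * FreeGroup.of (i, !β) ∧
      ψ (FreeGroup.of (i, β)) = (FreeGroup.of (i, β) ^ q * FreeGroup.of (i, !β)) ^ p *
        FreeGroup.of (i, β) := by
  obtain ⟨ψ, hψ, hψi, hψj⟩ := exists_twist i (!β) q
  obtain ⟨ω, hω, hωi, hωj⟩ := exists_twist i β p
  rw [Bool.not_not] at hψi
  have hne : (i, β) ≠ (i, !β) := by simp
  refine ⟨ψ * ω, fun m hm => (hψ m hm).mul (hω m hm), fun j hj γ => ?_, ?_, ?_⟩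
  · rw [MulAut.mul_apply, hωj _ (by simp [hj]), hψj _ (by simp [hj])]
  · rw [MulAut.mul_apply, hωj _ hne.symm, hψi]
  · rw [MulAut.mul_apply, hωi, map_mul, map_zpow, hψi, hψj _ hne]

-- Twists along the two curves of a handle run Euclid's algorithm on the values of `t`.
theorem exists_levelAut_map_eq_one {g : ℕ} {W : Type*} [Group W] {S : Subgroup W}
    (t : S →* Multiplicative ℤ) (i : Fin g) (β : Bool) (Ψ : FreeGroup (SurfaceGen g) →* W)
    (a b : S) (ha : Ψ (FreeGroup.of (i, β)) = a) (hb : Ψ (FreeGroup.of (i, !β)) = b) :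
    ∃ ψ : MulAut (FreeGroup (SurfaceGen g)), (∀ m, (i : ℕ) < m → IsLevelAut m ψ) ∧
      (∀ j : Fin g, j ≠ i → ∀ γ, ψ (FreeGroup.of (j, γ)) = FreeGroup.of (j, γ)) ∧
      ∃ c : S, Ψ (ψ (FreeGroup.of (i, β))) = c ∧ t c = 1 := by
  induction hN : (t a).toAdd.natAbs using Nat.strong_induction_on generalizing Ψ a b with
  | _ N ih =>
  subst hN
  rcases eq_or_ne (t a).toAdd 0 with hzero | hne
  · exact ⟨1, fun _ _ => IsLevelAut.one, fun _ _ _ => rfl, a, ha, hzero⟩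
  obtain ⟨q, p, hlt⟩ := exists_natAbs_add_mul_add_mul_lt hne (t b).toAdd
  obtain ⟨ψ, hψ, hψj, hψb, hψa⟩ := exists_twist_twist i β q p
  obtain ⟨ω, hω, hωj, hωa⟩ := ih _ hlt (Ψ.comp ψ.toMonoidHom) ((a ^ q * b) ^ p * a) (a ^ q * b)
    (by simp [hψa, ha, hb]) (by simp [hψb, ha, hb])
    (by simp [mul_comm])
  exact ⟨ψ * ω, fun m hm => (hψ m hm).mul (hω m hm), fun j hj γ =>
    (congrArg ψ (hωj j hj γ)).trans (hψj j hj γ), hωa⟩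

theorem IsPeriodicFinite.exists_translationNumber_hom {W : Type*} [Group W] {X : Set ℝ}
    (hX : IsPeriodicFinite X) (Φ : W →* LineLift) :
    ∃ n : ℕ, n ≠ 0 ∧ ∃ t : hX.stabilizer Φ →* Multiplicative ℤ,
      ∀ w, ((t w).toAdd : ℝ) = n * translationNumber (Φ w) := by
  obtain ⟨n, hn, hper⟩ := hX.exists_period
  choose t ht _ using fun w : hX.stabilizer Φ => hper (Φ w) w.2
  refine ⟨n, hn, MonoidHom.mk' (fun w => Multiplicative.ofAdd (t w)) fun v w => ?_, ht⟩
  rw [← ofAdd_add, Multiplicative.ofAdd.injective.eq_iff, ← Int.cast_inj (α := ℝ), Int.cast_add,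
    ht, ht, ht, Subgroup.coe_mul, map_mul, hX.translationNumber_mul v.2 w.2, mul_add]

theorem exists_levelAut_fixed {g : ℕ} (i : Fin g) (β : Bool)
    (Φ : FreeGroup (SurfaceGen g) →* LineLift) {X : Set ℝ} (hX : IsPeriodicFinite X)
    (hXi : ∀ γ, FreeGroup.of (i, γ) ∈ hX.stabilizer Φ) :
    ∃ ψ : MulAut (FreeGroup (SurfaceGen g)), (∀ m, (i : ℕ) < m → IsLevelAut m ψ) ∧
      (∀ j : Fin g, j ≠ i → ∀ γ, ψ (FreeGroup.of (j, γ)) = FreeGroup.of (j, γ)) ∧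
      ∃ q : ℝ, Φ (ψ (FreeGroup.of (i, β))) q = q := by
  obtain ⟨n, hn, t, ht⟩ := hX.exists_translationNumber_hom Φ
  obtain ⟨ψ, hψ, hψj, c, hc, htc⟩ := exists_levelAut_map_eq_one t i β (MonoidHom.id _)
    ⟨_, hXi β⟩ ⟨_, hXi !β⟩ rfl rfl
  rw [MonoidHom.id_apply] at hc
  have hτ : translationNumber (Φ (ψ (FreeGroup.of (i, β)))) = 0 := by
    have h := ht c
    rw [htc, ← hc, toAdd_one, Int.cast_zero, eq_comm, mul_eq_zero] at h
    exact h.resolve_left (Nat.cast_ne_zero.2 hn)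
  obtain ⟨q, hq⟩ := exists_eq_add_translationNumber
    (Φ (ψ (FreeGroup.of (i, β))) : CircleDeg1Lift) (Φ (ψ (FreeGroup.of (i, β)))).continuous
  exact ⟨ψ, hψ, hψj, q, by rw [hq, hτ, add_zero]⟩

end Normalization

/-! ### Induction on the number of handles -/

namespace IsVeryGoodLift

variable {g h : ℕ} {i i' : Fin g} {Φ : FreeGroup (SurfaceGen g) →* LineLift}

theorem exists_levelAut_fixed_pair (hi : (i' : ℕ) = i + 1) (hi' : (i' : ℕ) < h)
    (ih : ∀ Ψ : FreeGroup (SurfaceGen g) →* LineLift, IsVeryGoodLift h Ψ →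
      FiniteOrbitOn Ψ (handleSubgroup g i')) (hΦ : IsVeryGoodLift h Φ) :
    ∃ ψ : MulAut (FreeGroup (SurfaceGen g)), (∀ m, (i' : ℕ) < m → IsLevelAut m ψ) ∧
      (∃ q : ℝ, Φ (ψ (FreeGroup.of (i, false))) q = q) ∧
      ∃ q : ℝ, Φ (ψ (FreeGroup.of (i', true))) q = q := by
  have hii : i ≠ i' := fun h => by simp [h] at hi
  have hmem (β : Bool) : FreeGroup.of (i, β) ∈ handleSubgroup g i' :=
    of_mem_handleSubgroup (by simp [hi])
  obtain ⟨X, hX, hXΦ⟩ := ih Φ hΦ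
  obtain ⟨ψ, hψ, -, q, hq⟩ := exists_levelAut_fixed i false Φ hX fun γ => hXΦ (hmem γ)
  have hΦψ := hΦ.comp (hψ h (by lia))
  obtain ⟨ω, hω, hωi⟩ := exists_swapAut hi
  obtain ⟨Y, hY, hYΦ⟩ := ih _ (hΦψ.comp (hω h hi'))
  obtain ⟨θ, hθ, hθj, q', hq'⟩ := exists_levelAut_fixed i' true (Φ.comp ψ.toMonoidHom) hY
    fun γ => hωi γ ▸ hYΦ (hmem γ)
  refine ⟨ψ * θ, fun m hm => (hψ m (by lia)).mul (hθ m hm), ⟨q, ?_⟩, q', hq'⟩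
  rw [MulAut.mul_apply, hθj i hii, hq]

theorem finiteOrbitOn_of_fixed_pair (hi : (i' : ℕ) = i + 1) (hi' : (i' : ℕ) < h)
    (ih : ∀ Ψ : FreeGroup (SurfaceGen g) →* LineLift, IsVeryGoodLift h Ψ →
      FiniteOrbitOn Ψ (handleSubgroup g i')) (hΦ : IsVeryGoodLift h Φ) {q q' : ℝ}
    (hq : Φ (FreeGroup.of (i, false)) q = q) (hq' : Φ (FreeGroup.of (i', true)) q' = q') :
    FiniteOrbitOn Φ (handleSubgroup g (i' + 1)) := by
  have hii : i ≠ i' := fun h => by simp [h] at hi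
  obtain ⟨μ, hμ, hμa, hμb, hμj⟩ := exists_mixAut hi
  obtain ⟨X, hX, hXμ⟩ := ih _ (hΦ.comp (hμ h hi'))
  have hXΦ {w : FreeGroup (SurfaceGen g)} (hw : w ∈ handleSubgroup g i') :
      μ w ∈ hX.stabilizer Φ := hXμ hw
  have hmem (β : Bool) : FreeGroup.of (i, β) ∈ handleSubgroup g i' :=
    of_mem_handleSubgroup (by simp [hi])
  obtain ⟨σ, hΦσ, hσ, -⟩ := hΦ
  obtain ⟨Y, hY, hYi, hYa', hYj⟩ := hσ.exists_stabilizer_mix hΦσ hii hq hq' hX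
    (hμa ▸ hXΦ (hmem false)) (hμb ▸ hXΦ (hmem true))
  obtain ⟨E, hE, hEb', hEj⟩ := hσ.exists_stabilizer_pair hΦσ hii hq hq' hY (hYi true) hYa'
  refine ⟨E, hE, (Subgroup.closure_le _).2 ?_⟩
  rintro _ ⟨⟨j, β⟩, hj : (j : ℕ) < i' + 1, rfl⟩
  rcases lt_trichotomy j i with hlt | rfl | hlt
  · refine hEj _ (hYj _ hlt.ne (by lia) ?_)
    exact hμj j hlt β ▸ hXΦ (of_mem_handleSubgroup (by lia))
  · exact hEj _ (hYi β)
  · obtain rfl : j = i' := by lia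
    cases β
    · exact hEj _ hYa'
    · exact hEb'

theorem finiteOrbitOn (hhg : h < g) (k : ℕ) (hk : k + 1 ≤ h) (hΦ : IsVeryGoodLift h Φ) :
    FiniteOrbitOn Φ (handleSubgroup g (k + 1)) := by
  induction k generalizing Φ with
  | zero => exact hΦ.finiteOrbitOn_one hk
  | succ k ih =>
  let i : Fin g := ⟨k, by lia⟩
  let i' : Fin g := ⟨k + 1, by lia⟩
  have hi : (i' : ℕ) = i + 1 := rfl
  have ih' (Ψ) (hΨ : IsVeryGoodLift h Ψ) : FiniteOrbitOn Ψ (handleSubgroup g i') :=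
    ih (by lia) hΨ
  obtain ⟨ψ, hψ, ⟨q, hq⟩, q', hq'⟩ := exists_levelAut_fixed_pair hi hk ih' hΦ
  rw [← finiteOrbitOn_comp_levelAut_iff (hψ _ (Nat.lt_succ_self _))]
  exact finiteOrbitOn_of_fixed_pair hi hk ih' (hΦ.comp (hψ h hk)) hq hq'

end IsVeryGoodLift

theorem mainTheorem9 (g : ℕ) (hg : 2 ≤ g) (ρ : CircleRep (SurfaceGroup g)) (hρ : ρ.PathRigid)
    (h : ℕ) (hh : 1 ≤ h) (hhg : h < g) (H : Subgroup (SurfaceGroup g))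
    (hH : IsOneHoledSubsurfaceGroup h H)
    (hT : ∀ K : Subgroup (SurfaceGroup g),
      IsOneHoledSubsurfaceGroup 1 K → K ≤ H → ρ.HasFiniteOrbit K) :
    ρ.HasFiniteOrbit H := by
  obtain ⟨s, ⟨φ, hφ⟩, rfl⟩ := hH
  have hHmap : Subgroup.closure (s '' {j | (j.1 : ℕ) < h}) =
      ((handleSubgroup g h).map (surfaceMk g)).map φ.toMonoidHom := by
    rw [map_handleSubgroup, MonoidHom.map_closure, image_image]
    exact congrArg _ (image_congr fun j _ => hφ j)
  rw [hHmap] at hT ⊢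
  obtain ⟨Φ, hΦ⟩ := exists_isRepLift (MonoidHom.comp ρ φ.toMonoidHom : CircleRep (SurfaceGroup g))
  rw [← CircleRep.hasFiniteOrbit_comp_iff, hasFiniteOrbit_map_iff hΦ]
  have hverygood : IsVeryGoodLift h Φ := by
    refine ⟨_, hΦ, hρ.isRotationRigid.comp φ, fun K hK hle => ?_⟩
    rw [CircleRep.hasFiniteOrbit_comp_iff]
    exact hT _ (hK.map φ) (Subgroup.map_mono hle)
  obtain ⟨k, rfl⟩ := Nat.exists_eq_succ_of_ne_zero (Nat.one_le_iff_ne_zero.1 hh)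
  exact hverygood.finiteOrbitOn hhg k le_rfl
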